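/- Let $(\widehat\rho_\bullet,\otimes_\bullet,\iota_\bullet,\varepsilon_\bullet)$ be a (strict, unital) symmetric tensor C*-category whose objects are the tensor powers $\rho_\bullet^r$, $r\in\mathbb N=\{0,1,2,\dots\}$, of a generating object $\rho_\bullet$, with $(\iota_\bullet,\iota_\bullet)=\mathbb C 1$. Let $\mathcal O_{\rho_\bullet}$ be its Doplicher--Roberts algebra (the C*-algebra generated by the arrow spaces $(\rho_\bullet^r,\rho_\bullet^s)$, $t$ being identified with $t\otimes 1_{\rho_\bullet}$) and $\rho_*$ its canonical endomorphism $t\mapsto 1_{\rho_\bullet}\otimes t$. Assume that $\rho_\bullet$ is amenable: for all $r,s\in\mathbb N$ the canonical map $t\mapsto t$ is a bijection of $(\rho_\bullet^r,\rho_\bullet^s)$ onto $(\rho_*^r,\rho_*^s)=\{t\in\mathcal O_{\rho_\bullet}: t\,\rho_*^r(a)=\rho_*^s(a)\,t\ \ \forall a\in\mathcal O_{\rho_\bullet}\}$. Let $K=\mathrm{aut}_{\varepsilon_\bullet}\widehat\rho_\bullet$ be the group of C*-autofunctors of $\widehat\rho_\bullet$ that fix the objects and preserve $\otimes_\bullet$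 and $\varepsilon_\bullet$, with the topology of pointwise norm convergence on $\mathcal O_{\rho_\bullet}$. Let $X$ be a compact Hausdorff space. Let $\mathrm{sym}(X,\widehat\rho_\bullet)$ be the set of isomorphism classes of symmetric tensor C*-categories $\mathcal T$ over $X$ (i.e. with $(\iota,\iota)$ identified with $C(X)$) that are locally trivial with fibre $\widehat\rho_\bullet$: every point of $X$ has a closed neighbourhood $W$ with a local chart, that is, a $C(W)$-linear isomorphism, preserving tensor product and symmetry, of the restriction $\mathcal T_W$ onto the constant bundle $W\widehat\rho_\bullet$, where the map of the charts on objects does not depend on $W$. Isomorphisms are C*-isofunctors that preserve tensor product and symmetry and induce the identity on $C(X)$. Let $H^1(X,K)$ be the set of equivalence classes of $K$-valued cocycles $(\{U_i\},\{g_{ij}\})$ on finite open covers of $X$ (continuous $g_{ij}:U_i\cap U_j\to K$ with $g_{ij}g_{jk}=g_{ik}$ on $U_i\cap U_j\cap U_k$), where $(\{U_i\},\{g_{ij}\})\sim(\{U'_l\},\{g'_{lm}\})$ if there are continuous $u_{il}:U_i\cap U'_l\to K$ with $g_{ij}u_{jm}=u_{il}g'_{lm}$ on $U_i\cap U_j\cap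 U'_l\cap U'_m$. Then there is a bijection $$\Phi:\ \mathrm{sym}(X,\widehat\rho_\bullet)\ \longrightarrow\ H^1(X,K)$$ such that: 1. every $\mathcal T$ has finite systems of local charts $\pi_i:\mathcal T_{W_i}\to W_i\widehat\rho_\bullet$ over closed sets $W_i$ whose interiors cover $X$; for each such system the transition functions $g_{ij}=\pi_i\circ\pi_j^{-1}$ form a $K$-cocycle on the cover by the interiors of the $W_i$, and $\Phi[\mathcal T]$ is its class; 2. for every $K$-cocycle $c=(\{U_i\},\{g_{ij}\})$ there is such a $\mathcal T$ that is the glueing of the trivial bundles over the $U_i$ along $c$ (its arrows are the families $(t_i)$ of continuous maps $t_i:U_i\to(\rho_\bullet^r,\rho_\bullet^s)$ with $t_i=g_{ij}t_j$ on $U_i\cap U_j$, with pointwise operations), and $\Phi^{-1}[c]$ is the class of any such glueing. -/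

import Mathlib

open Topology TopologicalSpace

universe u v t w w'

/-! ### C*-categories, tensor C*-categories, symmetric tensor C*-categories -/

/-- A unital C*-category with set of objects `Ob`: the arrow spaces `Hom a b` are complex Banach
spaces, composition is bilinear and submultiplicative, `adj` is an antilinear isometric involutive
contravariant functor, and the C*-identity `‖t* ∘ t‖ = ‖t‖ ^ 2` holds.
`comp t' t` is the composition `t' ∘ t`. -/
structure CStarCat (Ob : Type w) where
  Hom : Ob → Ob → Type v
  [normedAddCommGroup : ∀ a b, NormedAddCommGroup (Hom a b)]
  [normedSpace : ∀ a b, NormedSpace ℂ (Hom a b)]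
  [completeSpace : ∀ a b, CompleteSpace (Hom a b)]
  id : ∀ a, Hom a a
  comp : ∀ {a b c}, Hom b c → Hom a b → Hom a c
  adj : ∀ {a b}, Hom a b → Hom b a
  comp_id : ∀ {a b} (t : Hom a b), comp t (id a) = t
  id_comp : ∀ {a b} (t : Hom a b), comp (id b) t = t
  comp_assoc : ∀ {a b c d} (t'' : Hom c d) (t' : Hom b c) (t : Hom a b),
    comp (comp t'' t') t = comp t'' (comp t' t)
  comp_add : ∀ {a b c} (t' : Hom b c) (t s : Hom a b), comp t' (t + s) = comp t' t + comp t' s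
  add_comp : ∀ {a b c} (t' s' : Hom b c) (t : Hom a b), comp (t' + s') t = comp t' t + comp s' t
  comp_smul : ∀ {a b c} (z : ℂ) (t' : Hom b c) (t : Hom a b), comp t' (z • t) = z • comp t' t
  smul_comp : ∀ {a b c} (z : ℂ) (t' : Hom b c) (t : Hom a b), comp (z • t') t = z • comp t' t
  norm_comp_le : ∀ {a b c} (t' : Hom b c) (t : Hom a b), ‖comp t' t‖ ≤ ‖t'‖ * ‖t‖
  adj_adj : ∀ {a b} (t : Hom a b), adj (adj t) = t
  adj_add : ∀ {a b} (t s : Hom a b), adj (t + s) = adj t + adj s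
  adj_smul : ∀ {a b} (z : ℂ) (t : Hom a b), adj (z • t) = (starRingEnd ℂ z) • adj t
  adj_comp : ∀ {a b c} (t' : Hom b c) (t : Hom a b), adj (comp t' t) = comp (adj t) (adj t')
  norm_adj : ∀ {a b} (t : Hom a b), ‖adj t‖ = ‖t‖
  cstar_identity : ∀ {a b} (t : Hom a b), ‖comp (adj t) t‖ = ‖t‖ ^ 2

attribute [instance] CStarCat.normedAddCommGroup CStarCat.normedSpace CStarCat.completeSpace

/-- Transport of an arrow along equalities of objects. -/
def CStarCat.castHom {Ob : Type w} (C : CStarCat.{v} Ob) {a a' b b' : Ob} (ha : a = a')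
    (hb : b = b') (t : C.Hom a b) : C.Hom a' b' :=
  ha ▸ hb ▸ t

/-- A (strict) tensor C*-category. The tensor product of objects is the addition of the monoid
`Ob`, and the identity object `ι` is `0`; the tensor product of arrows is an associative, unital
C*-bifunctor. Transports `castHom` are inserted where two objects are equal only by the monoid
axioms. -/
structure TensorCStarCat (Ob : Type w) [AddMonoid Ob] extends CStarCat.{v} Ob where
  tensor : ∀ {a b c d}, Hom a b → Hom c d → Hom (a + c) (b + d)
  tensor_add : ∀ {a b c d} (t : Hom a b) (s s' : Hom c d),
    tensor t (s + s') = tensor t s + tensor t s'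
  add_tensor : ∀ {a b c d} (t t' : Hom a b) (s : Hom c d),
    tensor (t + t') s = tensor t s + tensor t' s
  tensor_smul : ∀ {a b c d} (z : ℂ) (t : Hom a b) (s : Hom c d),
    tensor t (z • s) = z • tensor t s
  smul_tensor : ∀ {a b c d} (z : ℂ) (t : Hom a b) (s : Hom c d),
    tensor (z • t) s = z • tensor t s
  norm_tensor_le : ∀ {a b c d} (t : Hom a b) (s : Hom c d), ‖tensor t s‖ ≤ ‖t‖ * ‖s‖
  tensor_id : ∀ a b, tensor (id a) (id b) = id (a + b)
  tensor_comp : ∀ {a b c a' b' c'} (t' : Hom b c) (t : Hom a b) (s' : Hom b' c') (s : Hom a' b'),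
    tensor (comp t' t) (comp s' s) = comp (tensor t' s') (tensor t s)
  tensor_adj : ∀ {a b c d} (t : Hom a b) (s : Hom c d), adj (tensor t s) = tensor (adj t) (adj s)
  tensor_assoc : ∀ {a b c d e f} (t : Hom a b) (s : Hom c d) (r : Hom e f),
    toCStarCat.castHom (add_assoc a c e) (add_assoc b d f) (tensor (tensor t s) r) =
      tensor t (tensor s r)
  id_zero_tensor : ∀ {a b} (t : Hom a b),
    toCStarCat.castHom (zero_add a) (zero_add b) (tensor (id 0) t) = t
  tensor_id_zero : ∀ {a b} (t : Hom a b),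
    toCStarCat.castHom (add_zero a) (add_zero b) (tensor t (id 0)) = t

/-- A symmetric tensor C*-category: `braid a b` is the unitary `ε(a, b) : ab → ba`. -/
structure SymTensorCStarCat (Ob : Type w) [AddMonoid Ob] extends TensorCStarCat.{v} Ob where
  braid : ∀ a b, Hom (a + b) (b + a)
  braid_adj_comp : ∀ a b, comp (adj (braid a b)) (braid a b) = id (a + b)
  braid_comp_adj : ∀ a b, comp (braid a b) (adj (braid a b)) = id (b + a)
  braid_naturality : ∀ {a b a' b'} (t : Hom a b) (t' : Hom a' b'),
    comp (braid b b') (tensor t t') = comp (tensor t' t) (braid a a')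
  braid_symm : ∀ a b, comp (braid b a) (braid a b) = id (a + b)
  braid_zero : ∀ a, toCStarCat.castHom (add_zero a) (zero_add a) (braid a 0) = id a
  zero_braid : ∀ a, toCStarCat.castHom (zero_add a) (add_zero a) (braid 0 a) = id a
  /-- `ε(ab, c) = (ε(a, c) ⊗ 1_b) ∘ (1_a ⊗ ε(b, c))` -/
  braid_hexagon : ∀ a b c,
    toCStarCat.castHom (add_assoc a b c) (add_assoc c a b).symm (braid (a + b) c) =
      comp (tensor (braid a c) (id b))
        (toCStarCat.castHom rfl (add_assoc a c b).symm (tensor (id a) (braid b c)))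

/-! ### The Doplicher-Roberts algebra of the generating object

A symmetric tensor C*-category with set of objects `ℕ` (under addition) is one whose objects are
the tensor powers `ρ ^ r`, `r ∈ ℕ`, of the generating object `ρ = 1`. -/

section DR

variable (S : TensorCStarCat.{v} ℕ)

/-- The relations defining the DR-algebra on the symbols `t`, where `t` is an arrow `ρ ^ r → ρ ^ s`:
linearity, composition of arrows, unit, and identification of `t` with `t ⊗ 1_ρ`. -/
inductive DRRel : FreeAlgebra ℂ (Σ p : ℕ × ℕ, S.Hom p.1 p.2) →
    FreeAlgebra ℂ (Σ p : ℕ × ℕ, S.Hom p.1 p.2) → Prop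
  | add {r s : ℕ} (t t' : S.Hom r s) :
      DRRel (FreeAlgebra.ι ℂ ⟨(r, s), t + t'⟩)
        (FreeAlgebra.ι ℂ ⟨(r, s), t⟩ + FreeAlgebra.ι ℂ ⟨(r, s), t'⟩)
  | smul {r s : ℕ} (z : ℂ) (t : S.Hom r s) :
      DRRel (FreeAlgebra.ι ℂ ⟨(r, s), z • t⟩) (z • FreeAlgebra.ι ℂ ⟨(r, s), t⟩)
  | comp {p r s : ℕ} (t' : S.Hom r s) (t : S.Hom p r) :
      DRRel (FreeAlgebra.ι ℂ ⟨(p, s), S.comp t' t⟩)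
        (FreeAlgebra.ι ℂ ⟨(r, s), t'⟩ * FreeAlgebra.ι ℂ ⟨(p, r), t⟩)
  | one : DRRel (FreeAlgebra.ι ℂ ⟨(0, 0), S.id 0⟩) 1
  | tensor {r s : ℕ} (t : S.Hom r s) :
      DRRel (FreeAlgebra.ι ℂ ⟨(r + 1, s + 1), S.tensor t (S.id 1)⟩) (FreeAlgebra.ι ℂ ⟨(r, s), t⟩)

/-- The algebra `⊕_k lim_r (ρ ^ r, ρ ^ (r + k))`, the limit being along the maps `t ↦ t ⊗ 1_ρ`:
every product of two symbols reduces to a single symbol, by tensoring both with powers of `1_ρ`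
until they are composable. -/
def DRAlg : Type v := RingQuot (DRRel S)

noncomputable instance : Ring (DRAlg S) := inferInstanceAs (Ring (RingQuot (DRRel S)))

noncomputable instance : Algebra ℂ (DRAlg S) := inferInstanceAs (Algebra ℂ (RingQuot (DRRel S)))

variable {S}

/-- The image of an arrow `t : ρ ^ r → ρ ^ s`. -/
noncomputable def DRAlg.of {r s : ℕ} (t : S.Hom r s) : DRAlg S :=
  RingQuot.mkAlgHom ℂ (DRRel S) (FreeAlgebra.ι ℂ ⟨(r, s), t⟩)

theorem DRAlg.of_add {r s : ℕ} (t t' : S.Hom r s) :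
    DRAlg.of (t + t') = DRAlg.of t + DRAlg.of t' := by
  unfold DRAlg.of
  rw [RingQuot.mkAlgHom_rel ℂ (DRRel.add t t'), map_add]; rfl

theorem DRAlg.of_smul {r s : ℕ} (z : ℂ) (t : S.Hom r s) :
    DRAlg.of (z • t) = z • DRAlg.of t := by
  unfold DRAlg.of
  rw [RingQuot.mkAlgHom_rel ℂ (DRRel.smul z t), map_smul]; rfl

theorem DRAlg.of_comp {p r s : ℕ} (t' : S.Hom r s) (t : S.Hom p r) :
    DRAlg.of (S.comp t' t) = DRAlg.of t' * DRAlg.of t := by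
  unfold DRAlg.of
  rw [RingQuot.mkAlgHom_rel ℂ (DRRel.comp t' t), map_mul]; rfl

theorem DRAlg.of_id_zero : DRAlg.of (S.id 0) = 1 := by
  unfold DRAlg.of
  rw [RingQuot.mkAlgHom_rel ℂ (DRRel.one), map_one]; rfl

theorem DRAlg.of_tensor_one {r s : ℕ} (t : S.Hom r s) :
    DRAlg.of (S.tensor t (S.id 1)) = DRAlg.of t := by
  unfold DRAlg.of
  rw [RingQuot.mkAlgHom_rel ℂ (DRRel.tensor t)]

theorem DRAlg.of_castHom {r s r' s' : ℕ} (hr : r = r') (hs : s = s') (t : S.Hom r s) :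
    DRAlg.of (S.castHom hr hs t) = DRAlg.of t := by
  subst hr hs; rfl

theorem DRAlg.of_id (r : ℕ) : DRAlg.of (S.id r) = 1 := by
  induction r with
  | zero => exact DRAlg.of_id_zero
  | succ r ih => rw [← S.tensor_id, DRAlg.of_tensor_one, ih]

/-- Universal property of `DRAlg`. -/
noncomputable def DRAlg.lift {B : Type*} [Ring B] [Algebra ℂ B]
    (j : ∀ {r s : ℕ}, S.Hom r s → B)
    (h_add : ∀ {r s : ℕ} (t t' : S.Hom r s), j (t + t') = j t + j t')
    (h_smul : ∀ {r s : ℕ} (z : ℂ) (t : S.Hom r s), j (z • t) = z • j t)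
    (h_comp : ∀ {p r s : ℕ} (t' : S.Hom r s) (t : S.Hom p r), j (S.comp t' t) = j t' * j t)
    (h_one : j (S.id 0) = 1)
    (h_tensor : ∀ {r s : ℕ} (t : S.Hom r s), j (S.tensor t (S.id 1)) = j t) :
    DRAlg S →ₐ[ℂ] B :=
  RingQuot.liftAlgHom ℂ
    ⟨FreeAlgebra.lift ℂ fun x : (Σ p : ℕ × ℕ, S.Hom p.1 p.2) => j x.2, by
      intro x y h
      cases h <;> simp [h_add, h_smul, h_comp, h_one, h_tensor]⟩

theorem DRAlg.lift_of {B : Type*} [Ring B] [Algebra ℂ B]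
    (j : ∀ {r s : ℕ}, S.Hom r s → B) (h1 h2 h3 h4 h5) {r s : ℕ} (t : S.Hom r s) :
    DRAlg.lift (S := S) j h1 h2 h3 h4 h5 (DRAlg.of t) = j t := by
  unfold DRAlg.lift DRAlg.of
  erw [RingQuot.liftAlgHom_mkAlgHom_apply]
  simp

theorem DRAlg.algHom_ext {B : Type*} [Ring B] [Algebra ℂ B] {f g : DRAlg S →ₐ[ℂ] B}
    (h : ∀ {r s : ℕ} (t : S.Hom r s), f (DRAlg.of t) = g (DRAlg.of t)) : f = g := by
  apply RingQuot.ringQuot_ext' (S := ℂ)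
  ext x
  exact h x.2

theorem DRAlg.induction {P : DRAlg S → Prop} (h_scalar : ∀ z : ℂ, P (algebraMap ℂ _ z))
    (h_of : ∀ {r s : ℕ} (t : S.Hom r s), P (DRAlg.of t))
    (h_mul : ∀ x y, P x → P y → P (x * y)) (h_add : ∀ x y, P x → P y → P (x + y))
    (x : DRAlg S) : P x := by
  obtain ⟨a, rfl⟩ := RingQuot.mkAlgHom_surjective ℂ (DRRel S) x
  induction a using FreeAlgebra.induction with
  | grade0 z =>
    rw [AlgHom.commutes]
    exact h_scalar z
  | grade1 x => exact h_of x.2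
  | mul a b ha hb => rw [map_mul]; exact h_mul _ _ ha hb
  | add a b ha hb => rw [map_add]; exact h_add _ _ ha hb

variable (S)

/-- A *-representation of the *-algebra `DRAlg S` (with involution `t ↦ t*` on arrows) in a unital
C*-algebra. The bound in `norm_le` is the contractivity of *-morphisms. -/
structure DRRep (A : Type v) [CStarAlgebra A] where
  toAlgHom : DRAlg S →ₐ[ℂ] A
  map_adj : ∀ {r s : ℕ} (t : S.Hom r s),
    toAlgHom (DRAlg.of (S.adj t)) = star (toAlgHom (DRAlg.of t))
  norm_le : ∀ {r s : ℕ} (t : S.Hom r s), ‖toAlgHom (DRAlg.of t)‖ ≤ ‖t‖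

/-- The values `‖φ x‖`, for `φ` a *-representation. -/
def drValues (x : DRAlg S) : Set ℝ :=
  {c | ∃ (A : Type v) (_ : CStarAlgebra A) (φ : DRRep S A), c = ‖φ.toAlgHom x‖}

/-- The greatest C*-seminorm on `DRAlg S`. It is invariant under the circle action, and is the
unique C*-norm for which the circle action is isometric, as soon as there is one. -/
noncomputable def drNorm (x : DRAlg S) : ℝ := sSup (drValues S x)

theorem drValues_nonempty (x : DRAlg S) : (drValues S x).Nonempty :=
  ⟨_, PEmpty.{v + 1} → ℂ, inferInstance,
    ⟨DRAlg.lift (fun _ => 0) (by simp) (by simp) (by simp) (Subsingleton.elim _ _) (by simp),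
      fun _ => Subsingleton.elim _ _, fun t => by
        rw [DRAlg.lift_of, norm_zero]
        exact norm_nonneg t⟩, rfl⟩

theorem drValues_bddAbove (x : DRAlg S) : BddAbove (drValues S x) := by
  induction x using DRAlg.induction with
  | h_scalar z =>
    refine ⟨‖z‖, ?_⟩
    rintro _ ⟨A, _, φ, rfl⟩
    rw [AlgHom.commutes, Algebra.algebraMap_eq_smul_one]
    refine (norm_smul_le _ _).trans ?_
    have h1 : ‖(1 : A)‖ ≤ 1 := by
      rcases subsingleton_or_nontrivial A with h | h
      · rw [Subsingleton.elim (1 : A) 0, norm_zero]; exact zero_le_one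
      · rw [CStarRing.norm_one]
    nlinarith [norm_nonneg z]
  | h_of t =>
    refine ⟨‖t‖, ?_⟩
    rintro _ ⟨A, _, φ, rfl⟩
    exact φ.norm_le t
  | h_mul x y hx hy =>
    obtain ⟨a, ha⟩ := hx
    obtain ⟨b, hb⟩ := hy
    refine ⟨a * b, ?_⟩
    rintro _ ⟨A, _, φ, rfl⟩
    rw [map_mul]
    refine (norm_mul_le _ _).trans ?_
    have h1 := ha ⟨A, _, φ, rfl⟩
    have h2 := hb ⟨A, _, φ, rfl⟩
    exact mul_le_mul h1 h2 (norm_nonneg _) ((norm_nonneg _).trans h1)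
  | h_add x y hx hy =>
    obtain ⟨a, ha⟩ := hx
    obtain ⟨b, hb⟩ := hy
    refine ⟨a + b, ?_⟩
    rintro _ ⟨A, _, φ, rfl⟩
    rw [map_add]
    exact (norm_add_le _ _).trans (add_le_add (ha ⟨A, _, φ, rfl⟩) (hb ⟨A, _, φ, rfl⟩))

variable {S}

theorem DRRep.norm_le_drNorm {A : Type v} [CStarAlgebra A] (φ : DRRep S A) (x : DRAlg S) :
    ‖φ.toAlgHom x‖ ≤ drNorm S x :=
  le_csSup (drValues_bddAbove S x) ⟨A, _, φ, rfl⟩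

theorem drNorm_le {x : DRAlg S} {c : ℝ}
    (h : ∀ (A : Type v) [CStarAlgebra A] (φ : DRRep S A), ‖φ.toAlgHom x‖ ≤ c) :
    drNorm S x ≤ c :=
  csSup_le (drValues_nonempty S x) (by rintro _ ⟨A, _, φ, rfl⟩; exact h A φ)

theorem drNorm_nonneg (x : DRAlg S) : 0 ≤ drNorm S x := by
  obtain ⟨_, A, _, φ, rfl⟩ := drValues_nonempty S x
  exact (norm_nonneg _).trans (φ.norm_le_drNorm x)

variable (S)

/-- `drNorm` is a submultiplicative seminorm. -/
noncomputable def drSeminorm : RingSeminorm (DRAlg S) where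
  toFun := drNorm S
  map_zero' := le_antisymm (drNorm_le fun A _ φ => by simp) (drNorm_nonneg 0)
  add_le' x y := drNorm_le fun A _ φ => by
    rw [map_add]
    exact (norm_add_le _ _).trans (add_le_add (φ.norm_le_drNorm x) (φ.norm_le_drNorm y))
  neg' x := by
    have h : drValues S (-x) = drValues S x := by simp [drValues]
    unfold drNorm; rw [h]
  mul_le' x y := drNorm_le fun A _ φ => by
    rw [map_mul]
    exact (norm_mul_le _ _).trans (mul_le_mul (φ.norm_le_drNorm x) (φ.norm_le_drNorm y)
      (norm_nonneg _) (drNorm_nonneg x))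

noncomputable instance : SeminormedRing (DRAlg S) := (drSeminorm S).toSeminormedRing

theorem DRAlg.norm_def (x : DRAlg S) : ‖x‖ = drNorm S x := rfl

/-- The Doplicher-Roberts algebra `O_ρ`: the completion of `DRAlg S` in its C*-norm. (The involution
extending `t ↦ t*` is not needed below.) -/
abbrev DRCompletion : Type v := UniformSpace.Completion (DRAlg S)

variable {S}

/-- The image of an arrow `t : ρ ^ r → ρ ^ s` in `O_ρ`. -/
noncomputable def toDR {r s : ℕ} (t : S.Hom r s) : DRCompletion S := (DRAlg.of t : DRCompletion S)

theorem norm_lift_le {f : DRAlg S →ₐ[ℂ] DRAlg S}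
    (h : ∀ (A : Type v) [CStarAlgebra A] (φ : DRRep S A), ∃ ψ : DRRep S A,
      ∀ x, ψ.toAlgHom x = φ.toAlgHom (f x)) (x : DRAlg S) : ‖f x‖ ≤ ‖x‖ := by
  refine drNorm_le fun A _ φ => ?_
  obtain ⟨ψ, hψ⟩ := h A φ
  rw [← hψ]
  exact ψ.norm_le_drNorm x

theorem CStarCat.norm_id_le {Ob : Type w} (C : CStarCat.{v} Ob) (a : Ob) : ‖C.id a‖ ≤ 1 := by
  have h1 : C.adj (C.id a) = C.id a := by
    have := C.adj_comp (C.adj (C.id a)) (C.id a)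
    rw [C.comp_id, C.adj_adj, C.comp_id] at this
    exact this.symm
  have h2 := C.cstar_identity (C.id a)
  rw [h1, C.comp_id] at h2
  nlinarith [norm_nonneg (C.id a)]

theorem CStarCat.adj_id {Ob : Type w} (C : CStarCat.{v} Ob) (a : Ob) :
    C.adj (C.id a) = C.id a := by
  have := C.adj_comp (C.adj (C.id a)) (C.id a)
  rw [C.comp_id, C.adj_adj, C.comp_id] at this
  exact this.symm

variable (S)

/-- The canonical endomorphism on `DRAlg S`: `t ↦ 1_ρ ⊗ t`. -/
noncomputable def canEndAlg : DRAlg S →ₐ[ℂ] DRAlg S :=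
  DRAlg.lift (fun t => DRAlg.of (S.tensor (S.id 1) t))
    (fun t t' => by rw [S.tensor_add, DRAlg.of_add])
    (fun z t => by rw [S.tensor_smul, DRAlg.of_smul])
    (fun t' t => by
      rw [← DRAlg.of_comp, ← S.tensor_comp, S.comp_id])
    (by rw [S.tensor_id, DRAlg.of_id])
    (fun t => by
      rw [← S.tensor_assoc, DRAlg.of_castHom, DRAlg.of_tensor_one])

theorem canEndAlg_of {r s : ℕ} (t : S.Hom r s) :
    canEndAlg S (DRAlg.of t) = DRAlg.of (S.tensor (S.id 1) t) := DRAlg.lift_of _ _ _ _ _ _ t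

theorem norm_canEndAlg_le (x : DRAlg S) : ‖canEndAlg S x‖ ≤ ‖x‖ := by
  refine norm_lift_le (fun A _ φ => ⟨⟨φ.toAlgHom.comp (canEndAlg S), ?_, ?_⟩, fun x => rfl⟩) x
  · intro r s t
    simp only [AlgHom.comp_apply, canEndAlg_of]
    rw [← φ.map_adj, S.tensor_adj, S.adj_id]
  · intro r s t
    simp only [AlgHom.comp_apply, canEndAlg_of]
    refine (φ.norm_le _).trans ((S.norm_tensor_le _ _).trans ?_)
    nlinarith [S.norm_id_le 1, norm_nonneg t]

/-- The canonical endomorphism `ρ_*` of `O_ρ`. -/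
noncomputable def canEnd : DRCompletion S →+* DRCompletion S :=
  UniformSpace.Completion.mapRingHom (canEndAlg S).toRingHom
    (AddMonoidHomClass.continuous_of_bound (canEndAlg S) 1
      (fun x => by rw [one_mul]; exact norm_canEndAlg_le S x))

/-- The intertwiner space `(ρ_* ^ r, ρ_* ^ s)`. -/
def intertwiners (r s : ℕ) : Set (DRCompletion S) :=
  {t | ∀ a, t * (canEnd S)^[r] a = (canEnd S)^[s] a * t}

/-- `ρ` is amenable: the canonical functor, `t ↦ t`, maps every `(ρ ^ r, ρ ^ s)` bijectively onto
`(ρ_* ^ r, ρ_* ^ s)`. -/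
def Amenable : Prop :=
  ∀ r s : ℕ, Set.BijOn (toDR : S.Hom r s → DRCompletion S) Set.univ (intertwiners S r s)

end DR

/-! ### The topological group of automorphisms -/

section Aut

/-- The C*-autofunctors of `S` which are the identity on objects and preserve tensor product and
symmetry (bijective C*-functors are isometric). -/
@[ext]
structure AutEps (S : SymTensorCStarCat.{v} ℕ) where
  app : ∀ r s : ℕ, S.Hom r s ≃ₗᵢ[ℂ] S.Hom r s
  map_id : ∀ r, app r r (S.id r) = S.id r
  map_comp : ∀ {p r s : ℕ} (t' : S.Hom r s) (t : S.Hom p r),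
    app p s (S.comp t' t) = S.comp (app r s t') (app p r t)
  map_adj : ∀ {r s : ℕ} (t : S.Hom r s), app s r (S.adj t) = S.adj (app r s t)
  map_tensor : ∀ {r s r' s' : ℕ} (t : S.Hom r s) (t' : S.Hom r' s'),
    app (r + r') (s + s') (S.tensor t t') = S.tensor (app r s t) (app r' s' t')
  map_braid : ∀ r s, app (r + s) (s + r) (S.braid r s) = S.braid r s

variable {S : SymTensorCStarCat.{v} ℕ}

namespace AutEps

instance : One (AutEps S) :=
  ⟨⟨fun _ _ => LinearIsometryEquiv.refl ℂ _, fun _ => rfl, fun _ _ => rfl, fun _ => rfl,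
    fun _ _ => rfl, fun _ _ => rfl⟩⟩

instance : Mul (AutEps S) :=
  ⟨fun α β => ⟨fun r s => (β.app r s).trans (α.app r s),
    fun r => by simp [β.map_id, α.map_id],
    fun t' t => by simp [β.map_comp, α.map_comp],
    fun t => by simp [β.map_adj, α.map_adj],
    fun t t' => by simp [β.map_tensor, α.map_tensor],
    fun r s => by simp [β.map_braid, α.map_braid]⟩⟩

instance : Inv (AutEps S) :=
  ⟨fun α => ⟨fun r s => (α.app r s).symm,
    fun r => by rw [LinearIsometryEquiv.symm_apply_eq, α.map_id],
    fun t' t => by rw [LinearIsometryEquiv.symm_apply_eq, α.map_comp]; simp,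
    fun t => by rw [LinearIsometryEquiv.symm_apply_eq, α.map_adj]; simp,
    fun t t' => by rw [LinearIsometryEquiv.symm_apply_eq, α.map_tensor]; simp,
    fun r s => by rw [LinearIsometryEquiv.symm_apply_eq, α.map_braid]⟩⟩

theorem one_app {r s : ℕ} (t : S.Hom r s) : (1 : AutEps S).app r s t = t := rfl

theorem mul_app (α β : AutEps S) {r s : ℕ} (t : S.Hom r s) :
    (α * β).app r s t = α.app r s (β.app r s t) := rfl

theorem inv_app (α : AutEps S) {r s : ℕ} (t : S.Hom r s) :
    (α⁻¹).app r s t = (α.app r s).symm t := rfl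

theorem ext_app {α β : AutEps S} (h : ∀ {r s : ℕ} (t : S.Hom r s), α.app r s t = β.app r s t) :
    α = β := by
  apply AutEps.ext
  funext r s
  ext t
  exact h t

instance : Group (AutEps S) :=
  Group.ofLeftAxioms (fun _ _ _ => rfl) (fun _ => rfl)
    (fun α => ext_app fun t => by rw [mul_app, inv_app, one_app]; simp)

/-- The action of an autofunctor on `DRAlg S`. -/
noncomputable def extAlg (α : AutEps S) :
    DRAlg S.toTensorCStarCat →ₐ[ℂ] DRAlg S.toTensorCStarCat :=
  DRAlg.lift (fun t => DRAlg.of (α.app _ _ t))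
    (fun t t' => by rw [map_add, DRAlg.of_add])
    (fun z t => by rw [map_smul, DRAlg.of_smul])
    (fun t' t => by rw [α.map_comp, DRAlg.of_comp])
    (by rw [α.map_id, DRAlg.of_id])
    (fun t => by rw [α.map_tensor, α.map_id, DRAlg.of_tensor_one])

theorem extAlg_of (α : AutEps S) {r s : ℕ} (t : S.Hom r s) :
    α.extAlg (DRAlg.of t) = DRAlg.of (α.app r s t) := DRAlg.lift_of _ _ _ _ _ _ t

theorem norm_extAlg_le (α : AutEps S) (x : DRAlg S.toTensorCStarCat) : ‖α.extAlg x‖ ≤ ‖x‖ := by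
  refine norm_lift_le (fun A _ φ => ⟨⟨φ.toAlgHom.comp α.extAlg, ?_, ?_⟩, fun x => rfl⟩) x
  · intro r s t
    simp only [AlgHom.comp_apply, extAlg_of]
    rw [← φ.map_adj, α.map_adj]
  · intro r s t
    simp only [AlgHom.comp_apply, extAlg_of]
    exact (φ.norm_le _).trans (by rw [LinearIsometryEquiv.norm_map])

theorem continuous_extAlg (α : AutEps S) : Continuous α.extAlg.toRingHom :=
  AddMonoidHomClass.continuous_of_bound α.extAlg 1
    (fun x => by rw [one_mul]; exact norm_extAlg_le α x)

/-- The automorphism of `O_ρ` extending an autofunctor. -/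
noncomputable def extDR (α : AutEps S) :
    DRCompletion S.toTensorCStarCat →+* DRCompletion S.toTensorCStarCat :=
  UniformSpace.Completion.mapRingHom α.extAlg.toRingHom α.continuous_extAlg

/-- The topology of pointwise (norm) convergence on `O_ρ`. -/
noncomputable instance : TopologicalSpace (AutEps S) :=
  TopologicalSpace.induced
    (fun (α : AutEps S) (x : DRCompletion S.toTensorCStarCat) => α.extDR x) inferInstance

theorem extAlg_mul (α β : AutEps S) : (α * β).extAlg = α.extAlg.comp β.extAlg :=
  DRAlg.algHom_ext fun t => by simp [extAlg_of, mul_app]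

theorem extAlg_one : (1 : AutEps S).extAlg = AlgHom.id ℂ _ :=
  DRAlg.algHom_ext fun t => by simp [extAlg_of, one_app]

theorem extDR_coe (α : AutEps S) (x : DRAlg S.toTensorCStarCat) :
    α.extDR (x : DRCompletion S.toTensorCStarCat) = (α.extAlg x : DRAlg S.toTensorCStarCat) :=
  UniformSpace.Completion.mapRingHom_coe _ x

theorem continuous_extDR (α : AutEps S) : Continuous α.extDR :=
  UniformSpace.Completion.continuous_map

theorem extDR_mul (α β : AutEps S) (x : DRCompletion S.toTensorCStarCat) :
    (α * β).extDR x = α.extDR (β.extDR x) := by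
  induction x using UniformSpace.Completion.induction_on with
  | hp => exact isClosed_eq (continuous_extDR _)
            ((continuous_extDR _).comp (continuous_extDR _))
  | ih x => rw [extDR_coe, extDR_coe, extDR_coe, extAlg_mul]; rfl

theorem extDR_one (x : DRCompletion S.toTensorCStarCat) : (1 : AutEps S).extDR x = x := by
  induction x using UniformSpace.Completion.induction_on with
  | hp => exact isClosed_eq (continuous_extDR _) continuous_id
  | ih x => rw [extDR_coe, extAlg_one]; rfl

theorem norm_extDR_le (α : AutEps S) (x : DRCompletion S.toTensorCStarCat) :
    ‖α.extDR x‖ ≤ ‖x‖ := by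
  induction x using UniformSpace.Completion.induction_on with
  | hp => exact isClosed_le (continuous_extDR _).norm continuous_norm
  | ih x =>
    rw [extDR_coe, UniformSpace.Completion.norm_coe, UniformSpace.Completion.norm_coe]
    exact norm_extAlg_le α x

theorem continuous_apply (x : DRCompletion S.toTensorCStarCat) :
    Continuous fun α : AutEps S => α.extDR x :=
  (_root_.continuous_apply x).comp
    (continuous_induced_dom (f := fun (α : AutEps S) (x : DRCompletion S.toTensorCStarCat) =>
      α.extDR x))

theorem continuous_iff {Y : Type*} [TopologicalSpace Y] {f : Y → AutEps S} :
    Continuous f ↔ ∀ x : DRCompletion S.toTensorCStarCat, Continuous fun y => (f y).extDR x := by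
  rw [continuous_induced_rng, continuous_pi_iff]; rfl

instance : IsTopologicalGroup (AutEps S) where
  continuous_mul := by
    rw [continuous_iff]
    intro x
    rw [continuous_iff_continuousAt]
    rintro ⟨α, β⟩
    simp only [extDR_mul]
    rw [ContinuousAt, tendsto_iff_norm_sub_tendsto_zero]
    have h1 : Filter.Tendsto (fun p : AutEps S × AutEps S => ‖p.2.extDR x - β.extDR x‖ +
        ‖p.1.extDR (β.extDR x) - α.extDR (β.extDR x)‖) (𝓝 (α, β)) (𝓝 (0 + 0)) := by
      refine Filter.Tendsto.add ?_ ?_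
      · exact tendsto_iff_norm_sub_tendsto_zero.1
          (((continuous_apply x).comp continuous_snd).tendsto (α, β))
      · exact tendsto_iff_norm_sub_tendsto_zero.1
          (((continuous_apply (β.extDR x)).comp continuous_fst).tendsto (α, β))
    rw [add_zero] at h1
    refine squeeze_zero (fun _ => norm_nonneg _) (fun p => ?_) h1
    have h2 : p.1.extDR (p.2.extDR x) - α.extDR (β.extDR x) =
        p.1.extDR (p.2.extDR x - β.extDR x) +
          (p.1.extDR (β.extDR x) - α.extDR (β.extDR x)) := by rw [map_sub]; abel
    rw [h2]
    exact (norm_add_le _ _).trans (by gcongr; exact norm_extDR_le _ _)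
  continuous_inv := by
    rw [continuous_iff]
    intro x
    rw [continuous_iff_continuousAt]
    intro α
    rw [ContinuousAt, tendsto_iff_norm_sub_tendsto_zero]
    have h1 := tendsto_iff_norm_sub_tendsto_zero.1
      ((continuous_apply (α⁻¹.extDR x)).tendsto α)
    refine squeeze_zero (fun _ => norm_nonneg _) (fun β => ?_) h1
    have h2 : β⁻¹.extDR x - α⁻¹.extDR x =
        β⁻¹.extDR (α.extDR (α⁻¹.extDR x) - β.extDR (α⁻¹.extDR x)) := by
      rw [map_sub, ← extDR_mul, ← extDR_mul β⁻¹ β, inv_mul_cancel, extDR_one, extDR_mul,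
        ← extDR_mul α, mul_inv_cancel, extDR_one]
    rw [h2, norm_sub_rev (β.extDR _)]
    exact norm_extDR_le _ _

end AutEps

end Aut

/-! ### The cohomology set `H¹(X, K)` -/

section Cohomology

variable (X : Type u) [TopologicalSpace X] (K : Type v) [Group K] [TopologicalSpace K]

/-- A `K`-cocycle: a finite open cover `U i` of `X` and continuous maps `g i j : U i ∩ U j → K` with
`g i j * g j k = g i k` on triple intersections. (The values of `g i j` outside `U i ∩ U j` are
irrelevant.) -/
structure Cocycle where
  n : ℕ
  U : Fin n → Set X
  isOpen : ∀ i, IsOpen (U i)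
  cover : ∀ x, ∃ i, x ∈ U i
  g : Fin n → Fin n → X → K
  continuousOn : ∀ i j, ContinuousOn (g i j) (U i ∩ U j)
  mul_eq : ∀ i j k, ∀ x ∈ U i ∩ U j ∩ U k, g i j x * g j k x = g i k x

variable {X K}

/-- Equivalence of cocycles: there are continuous `u i l : U i ∩ U' l → K` with
`g i j * u j m = u i l * g' l m` on `U i ∩ U j ∩ U' l ∩ U' m`. -/
def Cocycle.Equivalent (c c' : Cocycle X K) : Prop :=
  ∃ u : Fin c.n → Fin c'.n → X → K,
    (∀ i l, ContinuousOn (u i l) (c.U i ∩ c'.U l)) ∧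
    ∀ i j l m, ∀ x ∈ (c.U i ∩ c.U j) ∩ (c'.U l ∩ c'.U m),
      c.g i j x * u j m x = u i l x * c'.g l m x

theorem Cocycle.g_self (c : Cocycle X K) {i : Fin c.n} {x : X} (hx : x ∈ c.U i) :
    c.g i i x = 1 := by
  have := c.mul_eq i i i x ⟨⟨hx, hx⟩, hx⟩
  exact mul_eq_left.1 this

variable (X K)

/-- Equivalence of cocycles is an equivalence relation. -/
instance Cocycle.setoid [IsTopologicalGroup K] : Setoid (Cocycle X K) where
  r := Cocycle.Equivalent
  iseqv :=
    { refl := fun c => ⟨c.g, c.continuousOn, fun i j l m x hx => by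
        obtain ⟨⟨hi, hj⟩, hl, hm⟩ := hx
        rw [c.mul_eq i j m x ⟨⟨hi, hj⟩, hm⟩, c.mul_eq i l m x ⟨⟨hi, hl⟩, hm⟩]⟩
      symm := by
        rintro c c' ⟨u, hu, h⟩
        refine ⟨fun l i x => (u i l x)⁻¹, fun l i => ?_, fun l m i j x hx => ?_⟩
        · rw [Set.inter_comm]; exact (hu i l).inv
        · have := h i j l m x ⟨hx.2, hx.1⟩
          rw [eq_inv_mul_iff_mul_eq, ← mul_assoc, ← this, mul_inv_cancel_right]
      trans := by
        rintro c c' c'' ⟨u, hu, h⟩ ⟨u', hu', h'⟩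
        classical
        choose k hk using c'.cover
        -- the product `u i l * u' l p` does not depend on `l`
        have key : ∀ i p l l' x, x ∈ c.U i → x ∈ c''.U p → x ∈ c'.U l → x ∈ c'.U l' →
            u i l x * u' l p x = u i l' x * u' l' p x := by
          intro i p l l' x hi hp hl hl'
          have h1 := h i i l l' x ⟨⟨hi, hi⟩, hl, hl'⟩
          have h2 := h' l l' p p x ⟨⟨hl, hl'⟩, hp, hp⟩
          rw [c.g_self hi, one_mul] at h1
          rw [c''.g_self hp, mul_one] at h2
          rw [h1, ← h2, mul_assoc]
        refine ⟨fun i p x => u i (k x) x * u' (k x) p x, fun i p => ?_, ?_⟩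
        · intro x hx
          have hc : ContinuousOn (fun y => u i (k x) y * u' (k x) p y)
              ((c.U i ∩ c''.U p) ∩ c'.U (k x)) := by
            refine ContinuousOn.mul ((hu i (k x)).mono ?_) ((hu' (k x) p).mono ?_)
            · exact fun y hy => ⟨hy.1.1, hy.2⟩
            · exact fun y hy => ⟨hy.2, hy.1.2⟩
          have hop : IsOpen ((c.U i ∩ c''.U p) ∩ c'.U (k x)) :=
            ((c.isOpen i).inter (c''.isOpen p)).inter (c'.isOpen _)
          have hx' : x ∈ (c.U i ∩ c''.U p) ∩ c'.U (k x) := ⟨hx, hk x⟩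
          refine ((hc.continuousAt (hop.mem_nhds hx')).congr ?_).continuousWithinAt
          filter_upwards [hop.mem_nhds hx'] with y hy
          exact key i p (k x) (k y) y hy.1.1 hy.1.2 hy.2 (hk y)
        · intro i j p q x hx
          obtain ⟨⟨hi, hj⟩, hp, hq⟩ := hx
          have h1 := h i j (k x) (k x) x ⟨⟨hi, hj⟩, hk x, hk x⟩
          have h2 := h' (k x) (k x) p q x ⟨⟨hk x, hk x⟩, hp, hq⟩
          rw [c'.g_self (hk x), mul_one] at h1
          rw [c'.g_self (hk x), one_mul] at h2
          rw [← mul_assoc, h1, mul_assoc, h2] }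

/-- The cohomology set `H¹(X, K)`. -/
def CohomologySet [IsTopologicalGroup K] : Type (max u v) := Quotient (Cocycle.setoid X K)

end Cohomology

/-! ### Bundles of symmetric tensor C*-categories -/

section Bundles

/-- A symmetric tensor C*-category `T` over `X`, i.e. with `(ι, ι)` identified, as a C*-algebra,
with `C(X)`. -/
structure SymCatOver (X : Type u) [TopologicalSpace X] where
  Ob : Type w
  [addMonoid : AddMonoid Ob]
  cat : SymTensorCStarCat.{t} Ob
  scal : C(X, ℂ) ≃ₗ[ℂ] cat.Hom 0 0
  scal_one : scal 1 = cat.id 0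
  scal_mul : ∀ f f' : C(X, ℂ), scal (f * f') = cat.comp (scal f) (scal f')
  scal_star : ∀ f : C(X, ℂ), scal (star f) = cat.adj (scal f)

attribute [instance] SymCatOver.addMonoid

variable {X : Type u} [TopologicalSpace X]

/-- The `C(X)`-action `f t := f ⊗ t`. -/
noncomputable def SymCatOver.act (T : SymCatOver.{u, t, w} X) (f : C(X, ℂ)) {a b : T.Ob} (t : T.cat.Hom a b) :
    T.cat.Hom a b :=
  T.cat.castHom (zero_add a) (zero_add b) (T.cat.tensor (T.scal f) t)

/-- The closed span of the arrows `f t` with `f ∈ C(X)` vanishing on `W`. The arrow spaces of the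
restriction `T_W` to a closed set `W` are the quotients by these subspaces. -/
def SymCatOver.vanishing (T : SymCatOver.{u, t, w} X) (W : Set X) (a b : T.Ob) :
    Submodule ℂ (T.cat.Hom a b) :=
  (Submodule.span ℂ {s | ∃ (f : C(X, ℂ)) (t : T.cat.Hom a b),
    (∀ x ∈ W, f x = 0) ∧ s = T.act f t}).topologicalClosure

/-- The arrow spaces of the restriction `T_W`. -/
abbrev SymCatOver.RestrHom (T : SymCatOver.{u, t, w} X) (W : Set X) (a b : T.Ob) : Type _ :=
  T.cat.Hom a b ⧸ T.vanishing W a b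

/-- The restriction functor `T → T_W` on arrows. -/
def SymCatOver.restr (T : SymCatOver.{u, t, w} X) (W : Set X) {a b : T.Ob} (t : T.cat.Hom a b) :
    T.RestrHom W a b :=
  (T.vanishing W a b).mkQ t

/-- A local chart over `W` with fibre `S`: a `C(W)`-linear isomorphism of `T_W` onto the constant
bundle `W S`, with arrow spaces `C(W, S.Hom r s)`, preserving tensor product and symmetry, and given
by `e` on objects. Here `app hr hs`, where `hr : e a = r` and `hs : e b = s`, is its action
on arrows `a → b`. The operations of `T_W` are those of `T` passed to the quotient, and the operations
of `W S` are pointwise. -/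
structure LocalChart (T : SymCatOver.{u, t, w} X) (S : SymTensorCStarCat.{v} ℕ) (e : T.Ob ≃+ ℕ)
    (W : Set X) where
  app : ∀ {a b : T.Ob} {r s : ℕ}, e a = r → e b = s → (T.RestrHom W a b ≃ₗ[ℂ] C(W, S.Hom r s))
  map_id : ∀ {a : T.Ob} {r : ℕ} (h : e a = r) (x : W),
    app h h (T.restr W (T.cat.id a)) x = S.id r
  map_comp : ∀ {a b c : T.Ob} {p r s : ℕ} (hp : e a = p) (hr : e b = r) (hs : e c = s)
    (t' : T.cat.Hom b c) (t : T.cat.Hom a b) (x : W),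
    app hp hs (T.restr W (T.cat.comp t' t)) x =
      S.comp (app hr hs (T.restr W t') x) (app hp hr (T.restr W t) x)
  map_adj : ∀ {a b : T.Ob} {r s : ℕ} (hr : e a = r) (hs : e b = s) (t : T.cat.Hom a b) (x : W),
    app hs hr (T.restr W (T.cat.adj t)) x = S.adj (app hr hs (T.restr W t) x)
  map_act : ∀ {a b : T.Ob} {r s : ℕ} (hr : e a = r) (hs : e b = s) (f : C(X, ℂ))
    (t : T.cat.Hom a b) (x : W),
    app hr hs (T.restr W (T.act f t)) x = f x • app hr hs (T.restr W t) x
  map_tensor : ∀ {a b a' b' : T.Ob} {r s r' s' : ℕ} (hr : e a = r) (hs : e b = s)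
    (hr' : e a' = r') (hs' : e b' = s') (t : T.cat.Hom a b) (t' : T.cat.Hom a' b') (x : W),
    app (by rw [map_add, hr, hr'] : e (a + a') = r + r')
        (by rw [map_add, hs, hs'] : e (b + b') = s + s') (T.restr W (T.cat.tensor t t')) x =
      S.tensor (app hr hs (T.restr W t) x) (app hr' hs' (T.restr W t') x)
  map_braid : ∀ {a b : T.Ob} {r s : ℕ} (hr : e a = r) (hs : e b = s) (x : W),
    app (by rw [map_add, hr, hs] : e (a + b) = r + s) (by rw [map_add, hr, hs] : e (b + a) = s + r)
        (T.restr W (T.cat.braid a b)) x = S.braid r s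

/-- `T` is locally trivial with fibre `S`: every point has a closed neighbourhood with a local
chart, where the map of the charts on objects does not depend on the neighbourhood. -/
def LocallyTrivial (T : SymCatOver.{u, t, w} X) (S : SymTensorCStarCat.{v} ℕ) : Prop :=
  ∃ e : T.Ob ≃+ ℕ, ∀ x : X, ∃ W : Set X, IsClosed W ∧ W ∈ 𝓝 x ∧ Nonempty (LocalChart T S e W)

/-- An isomorphism of symmetric tensor C*-categories over `X`: a C*-isofunctor preserving tensor
product, symmetry and the elements of `C(X)`, given by `e` on objects. Here `app ha hb`, where
`ha : e a = a'` and `hb : e b = b'`, is its action on arrows `a → b`. -/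
structure SymCatOver.Iso (T : SymCatOver.{u, t, w} X) (T' : SymCatOver.{u, t, w'} X) where
  e : T.Ob ≃+ T'.Ob
  app : ∀ {a b : T.Ob} {a' b' : T'.Ob}, e a = a' → e b = b' →
    (T.cat.Hom a b ≃ₗ[ℂ] T'.cat.Hom a' b')
  map_id : ∀ {a : T.Ob} {a' : T'.Ob} (h : e a = a'), app h h (T.cat.id a) = T'.cat.id a'
  map_comp : ∀ {a b c : T.Ob} {a' b' c' : T'.Ob} (ha : e a = a') (hb : e b = b') (hc : e c = c')
    (t' : T.cat.Hom b c) (t : T.cat.Hom a b),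
    app ha hc (T.cat.comp t' t) = T'.cat.comp (app hb hc t') (app ha hb t)
  map_adj : ∀ {a b : T.Ob} {a' b' : T'.Ob} (ha : e a = a') (hb : e b = b') (t : T.cat.Hom a b),
    app hb ha (T.cat.adj t) = T'.cat.adj (app ha hb t)
  map_scal : ∀ f : C(X, ℂ), app (map_zero e) (map_zero e) (T.scal f) = T'.scal f
  map_tensor : ∀ {a b c d : T.Ob} {a' b' c' d' : T'.Ob} (ha : e a = a') (hb : e b = b')
    (hc : e c = c') (hd : e d = d') (t : T.cat.Hom a b) (s : T.cat.Hom c d),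
    app (by rw [map_add, ha, hc] : e (a + c) = a' + c')
        (by rw [map_add, hb, hd] : e (b + d) = b' + d') (T.cat.tensor t s) =
      T'.cat.tensor (app ha hb t) (app hc hd s)
  map_braid : ∀ {a b : T.Ob} {a' b' : T'.Ob} (ha : e a = a') (hb : e b = b'),
    app (by rw [map_add, ha, hb] : e (a + b) = a' + b')
        (by rw [map_add, ha, hb] : e (b + a) = b' + a') (T.cat.braid a b) = T'.cat.braid a' b'

/-- The identity isomorphism. -/
def SymCatOver.Iso.refl (T : SymCatOver.{u, t, w} X) : T.Iso T where
  e := AddEquiv.refl _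
  app {a b a' b'} ha hb := by
    have ha : a = a' := ha
    have hb : b = b' := hb
    subst ha hb
    exact LinearEquiv.refl ℂ _
  map_id h := by cases h; rfl
  map_comp ha hb hc t' t := by cases ha; cases hb; cases hc; rfl
  map_adj ha hb t := by cases ha; cases hb; rfl
  map_scal f := rfl
  map_tensor ha hb hc hd t s := by cases ha; cases hb; cases hc; cases hd; rfl
  map_braid ha hb := by cases ha; cases hb; rfl

/-- The inverse of an isomorphism. -/
def SymCatOver.Iso.symm {T T' : SymCatOver.{u, t, w} X} (F : T.Iso T') : T'.Iso T where
  e := F.e.symm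
  app ha hb := (F.app (F.e.symm_apply_eq.1 ha).symm (F.e.symm_apply_eq.1 hb).symm).symm
  map_id h := by rw [LinearEquiv.symm_apply_eq, F.map_id]
  map_comp ha hb hc t' t := by
    rw [LinearEquiv.symm_apply_eq, F.map_comp _ (F.e.symm_apply_eq.1 hb).symm]; simp
  map_adj ha hb t := by rw [LinearEquiv.symm_apply_eq, F.map_adj]; simp
  map_scal f := by rw [LinearEquiv.symm_apply_eq, F.map_scal]
  map_tensor ha hb hc hd t s := by
    rw [LinearEquiv.symm_apply_eq, F.map_tensor (F.e.symm_apply_eq.1 ha).symm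
      (F.e.symm_apply_eq.1 hb).symm (F.e.symm_apply_eq.1 hc).symm (F.e.symm_apply_eq.1 hd).symm]
    simp
  map_braid ha hb := by
    rw [LinearEquiv.symm_apply_eq, F.map_braid (F.e.symm_apply_eq.1 ha).symm
      (F.e.symm_apply_eq.1 hb).symm]

theorem SymCatOver.Iso.app_trans {T T' T'' : SymCatOver.{u, t, w} X} (F : T.Iso T')
    (G : T'.Iso T'') {a b : T.Ob} {p q : T'.Ob} {a' b' : T''.Ob} (h : F.e a = p) (k : F.e b = q)
    (h' : G.e p = a') (k' : G.e q = b') (s : T.cat.Hom a b) :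
    G.app (h ▸ h' : G.e (F.e a) = a') (k ▸ k' : G.e (F.e b) = b') (F.app rfl rfl s) =
      G.app h' k' (F.app h k s) := by
  subst h k; rfl

/-- The composition of two isomorphisms. -/
def SymCatOver.Iso.trans {T T' T'' : SymCatOver.{u, t, w} X} (F : T.Iso T') (G : T'.Iso T'') :
    T.Iso T'' where
  e := F.e.trans G.e
  app ha hb := (F.app rfl rfl).trans (G.app ha hb)
  map_id h := (congrArg (G.app h h) (F.map_id rfl)).trans (G.map_id h)
  map_comp ha hb hc t' t :=
    (congrArg (G.app ha hc) (F.map_comp rfl rfl rfl t' t)).trans (G.map_comp ha hb hc _ _)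
  map_adj ha hb t := (congrArg (G.app hb ha) (F.map_adj rfl rfl t)).trans (G.map_adj ha hb _)
  map_scal f :=
    (Iso.app_trans F G (map_zero F.e) (map_zero F.e) (map_zero G.e) (map_zero G.e) _).trans
      ((congrArg (G.app _ _) (F.map_scal f)).trans (G.map_scal f))
  map_tensor {a b c d a' b' c' d'} ha hb hc hd t s :=
    (Iso.app_trans F G (map_add F.e a c) (map_add F.e b d)
      ((map_add G.e _ _).trans (congrArg₂ (· + ·) ha hc))
      ((map_add G.e _ _).trans (congrArg₂ (· + ·) hb hd)) _).trans
      ((congrArg (G.app _ _) (F.map_tensor rfl rfl rfl rfl t s)).trans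
        (G.map_tensor ha hb hc hd _ _))
  map_braid {a b a' b'} ha hb :=
    (Iso.app_trans F G (map_add F.e a b) (map_add F.e b a)
      ((map_add G.e _ _).trans (congrArg₂ (· + ·) ha hb))
      ((map_add G.e _ _).trans (congrArg₂ (· + ·) hb ha)) _).trans
      ((congrArg (G.app _ _) (F.map_braid rfl rfl)).trans (G.map_braid ha hb))

variable (X)

/-- The locally trivial symmetric tensor C*-categories over `X` with fibre `S`. -/
def LTSymCat (S : SymTensorCStarCat.{v} ℕ) : Type (max u (t + 1) (w + 1)) :=
  {T : SymCatOver.{u, t, w} X // LocallyTrivial T S}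

/-- Isomorphism over `X` is an equivalence relation. -/
instance LTSymCat.setoid (S : SymTensorCStarCat.{v} ℕ) : Setoid (LTSymCat.{u, v, t, w} X S) where
  r T T' := Nonempty (T.1.Iso T'.1)
  iseqv := ⟨fun T => ⟨SymCatOver.Iso.refl T.1⟩, fun ⟨F⟩ => ⟨F.symm⟩,
    fun ⟨F⟩ ⟨G⟩ => ⟨F.trans G⟩⟩

/-- The set `sym(X, S)` of isomorphism classes of locally trivial symmetric tensor C*-categories
over `X` with fibre `S`. -/
def SymClasses (S : SymTensorCStarCat.{v} ℕ) : Type (max u (t + 1) (w + 1)) :=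
  Quotient (LTSymCat.setoid.{u, v, t, w} X S)

variable {X}

/-- A finite system of local charts, over closed sets the interiors of which cover `X`. -/
structure ChartSystem (T : SymCatOver.{u, t, w} X) (S : SymTensorCStarCat.{v} ℕ) where
  e : T.Ob ≃+ ℕ
  n : ℕ
  W : Fin n → Set X
  isClosed : ∀ i, IsClosed (W i)
  cover : ∀ x, ∃ i, x ∈ interior (W i)
  chart : ∀ i, LocalChart T S e (W i)

/-- `c` is the cocycle of transition functions of the charts `P`: it is defined over the interiors
of the sets `P.W i`, and `π_i = g i j ∘ π_j` there. -/
structure IsTransitionCocycle {T : SymCatOver.{u, t, w} X} {S : SymTensorCStarCat.{v} ℕ}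
    (P : ChartSystem T S) (c : Cocycle X (AutEps S)) : Prop where
  n_eq : c.n = P.n
  U_eq : ∀ i, c.U i = interior (P.W (Fin.cast n_eq i))
  transition : ∀ (i j : Fin c.n) (x : X) (hi : x ∈ P.W (Fin.cast n_eq i))
    (hj : x ∈ P.W (Fin.cast n_eq j)), x ∈ c.U i ∩ c.U j →
    ∀ {a b : T.Ob} {r s : ℕ} (hr : P.e a = r) (hs : P.e b = s) (t : T.cat.Hom a b),
      (P.chart (Fin.cast n_eq i)).app hr hs (T.restr _ t) ⟨x, hi⟩ =
        (c.g i j x).app r s ((P.chart (Fin.cast n_eq j)).app hr hs (T.restr _ t) ⟨x, hj⟩)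

/-- `T` is the glueing of the trivial bundles over the sets `U i` along the cocycle `c`: its arrows
are the families `(t_i)` of continuous sections `t_i ∈ C(U i, S.Hom r s)` with `t_i = g i j t_j` on
`U i ∩ U j`, with pointwise operations. (Over compact `X` such families are bounded.)
The map `π i` sends a family to its `i`-th member. -/
structure Glueing (T : SymCatOver.{u, t, w} X) (S : SymTensorCStarCat.{v} ℕ)
    (c : Cocycle X (AutEps S)) where
  e : T.Ob ≃+ ℕ
  π : ∀ (i : Fin c.n) {a b : T.Ob} {r s : ℕ}, e a = r → e b = s →
    (T.cat.Hom a b →ₗ[ℂ] C(c.U i, S.Hom r s))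
  glue : ∀ (i j : Fin c.n) (x : X) (hi : x ∈ c.U i) (hj : x ∈ c.U j) {a b : T.Ob} {r s : ℕ}
    (hr : e a = r) (hs : e b = s) (t : T.cat.Hom a b),
    π i hr hs t ⟨x, hi⟩ = (c.g i j x).app r s (π j hr hs t ⟨x, hj⟩)
  existsUnique : ∀ {a b : T.Ob} {r s : ℕ} (hr : e a = r) (hs : e b = s)
    (v : ∀ i, C(c.U i, S.Hom r s)),
    (∀ (i j : Fin c.n) (x : X) (hi : x ∈ c.U i) (hj : x ∈ c.U j),
      v i ⟨x, hi⟩ = (c.g i j x).app r s (v j ⟨x, hj⟩)) →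
    ∃! t : T.cat.Hom a b, ∀ i, π i hr hs t = v i
  map_id : ∀ i {a : T.Ob} {r : ℕ} (h : e a = r) (x : c.U i), π i h h (T.cat.id a) x = S.id r
  map_comp : ∀ i {a b d : T.Ob} {p r s : ℕ} (hp : e a = p) (hr : e b = r) (hs : e d = s)
    (t' : T.cat.Hom b d) (t : T.cat.Hom a b) (x : c.U i),
    π i hp hs (T.cat.comp t' t) x = S.comp (π i hr hs t' x) (π i hp hr t x)
  map_adj : ∀ i {a b : T.Ob} {r s : ℕ} (hr : e a = r) (hs : e b = s) (t : T.cat.Hom a b)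
    (x : c.U i), π i hs hr (T.cat.adj t) x = S.adj (π i hr hs t x)
  map_scal : ∀ i (f : C(X, ℂ)) (x : c.U i),
    π i (map_zero e) (map_zero e) (T.scal f) x = f x • S.id 0
  map_tensor : ∀ i {a b a' b' : T.Ob} {r s r' s' : ℕ} (hr : e a = r) (hs : e b = s)
    (hr' : e a' = r') (hs' : e b' = s') (t : T.cat.Hom a b) (t' : T.cat.Hom a' b') (x : c.U i),
    π i (by rw [map_add, hr, hr'] : e (a + a') = r + r')
        (by rw [map_add, hs, hs'] : e (b + b') = s + s') (T.cat.tensor t t') x =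
      S.tensor (π i hr hs t x) (π i hr' hs' t' x)
  map_braid : ∀ i {a b : T.Ob} {r s : ℕ} (hr : e a = r) (hs : e b = s) (x : c.U i),
    π i (by rw [map_add, hr, hs] : e (a + b) = r + s) (by rw [map_add, hr, hs] : e (b + a) = s + r)
        (T.cat.braid a b) x = S.braid r s

end Bundles

/-! The proof turns on the relation "`T` is a glueing along `c`" (`Glueing`), in which an arrow of
`T` is a compatible family of sections. It links both sides of the bijection and descends to the
graph of a bijection between classes, for four reasons.

A category with local charts is a glueing along its transition cocycle
(`ChartSystem.exists_cocycle`, `IsTransitionCocycle.nonempty_glueing`). To compare two charts at a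
point `x`, write a section vanishing at `x` as `f σ'` with `f x = 0`, by splitting off the square
root of the norm. Since charts are `C(X)`-linear and evaluations are automatically contractive, the
other chart also vanishes at `x`. The two evaluations are then surjections onto the fibre with the
same kernel, and so differ by an element of `K` (`FibreFunctor.exists_aut`). A partition of unity
recovers each arrow from its local sections.

Glueings along one cocycle are isomorphic (`Glueing.nonempty_iso`), and being a glueing is invariant
under isomorphism of `T` and equivalence of `c` (`Glueing.comap`, `Glueing.nonempty_of_equivalent`).
Conversely, if `T` is a glueing along `c` and along `c'`, the kernel argument, applied to the
evaluations of the two glueings, produces the maps `u i l` of an equivalence (`Glueing.equivalent`).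

Every cocycle has a glueing: the bounded sections with the supremum norm and pointwise operations
(`glueing`). It is locally trivial because sections over a closed subset of some `U i` extend to
global ones, by a Tietze theorem for Banach space values (`Glueing.locallyTrivial`).

Amenability enters only through the topology of `K`: it embeds each arrow space in the
Doplicher-Roberts algebra as a closed subspace, so that continuity into `K` means continuity on each
arrow (`Amenable.continuousOn_iff`). The condition `(ι, ι) = ℂ` is what makes the scalars of a
glueing equal to `C(X)` (`scalarSections_bijective`). -/

/-! ### Endomorphism C*-algebras and contractivity of *-functors -/

section Contractive

/-- The C*-algebra of endomorphisms of an object of a C*-category. -/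
def CStarCat.EndAlg {Ob : Type w} (C : CStarCat.{v} Ob) (a : Ob) : Type v := C.Hom a a

variable {Ob : Type w} (C : CStarCat.{v} Ob) (a : Ob)

theorem CStarCat.zero_comp {b c : Ob} (t : C.Hom a b) : C.comp (0 : C.Hom b c) t = 0 := by
  simpa using C.smul_comp 0 (0 : C.Hom b c) t

theorem CStarCat.comp_zero {b c : Ob} (t : C.Hom b c) : C.comp t (0 : C.Hom a b) = 0 := by
  simpa using C.comp_smul 0 t (0 : C.Hom a b)

instance : NormedAddCommGroup (C.EndAlg a) := inferInstanceAs (NormedAddCommGroup (C.Hom a a))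

instance : NormedSpace ℂ (C.EndAlg a) := inferInstanceAs (NormedSpace ℂ (C.Hom a a))

instance : CompleteSpace (C.EndAlg a) := inferInstanceAs (CompleteSpace (C.Hom a a))

instance : NormedRing (C.EndAlg a) where
  __ := (inferInstance : NormedAddCommGroup (C.EndAlg a))
  mul t' t := C.comp t' t
  one := C.id a
  mul_assoc := C.comp_assoc
  one_mul := C.id_comp
  mul_one := C.comp_id
  left_distrib := C.comp_add
  right_distrib := C.add_comp
  zero_mul := C.zero_comp a
  mul_zero := C.comp_zero a
  norm_mul_le := C.norm_comp_le

instance : StarRing (C.EndAlg a) where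
  star t := C.adj t
  star_involutive := C.adj_adj
  star_mul := C.adj_comp
  star_add := C.adj_add

noncomputable instance : Algebra ℂ (C.EndAlg a) :=
  Algebra.ofModule (fun z t' t => C.smul_comp z t' t) (fun z t' t => C.comp_smul z t' t)

noncomputable instance : CStarAlgebra (C.EndAlg a) where
  norm_smul_le z t := norm_smul_le z t
  norm_mul_self_le t := ((sq ‖t‖).symm.trans (C.cstar_identity t).symm).le
  star_smul z t := C.adj_smul z t

/-- Linear maps of arrow spaces compatible with composition and adjoints are contractive. -/
theorem CStarCat.norm_map_le {Ob' : Type w'} {C : CStarCat.{v} Ob} {D : CStarCat.{t} Ob'}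
    {a b : Ob} {r s : Ob'} (F : C.Hom a a →ₗ[ℂ] D.Hom r r) (G : C.Hom a b → D.Hom r s)
    (h_comp : ∀ t' t, F (C.comp t' t) = D.comp (F t') (F t))
    (h_adj : ∀ t, F (C.adj t) = D.adj (F t))
    (h : ∀ t, F (C.comp (C.adj t) t) = D.comp (D.adj (G t)) (G t)) (t : C.Hom a b) :
    ‖G t‖ ≤ ‖t‖ := by
  let φ : C.EndAlg a →⋆ₙₐ[ℂ] D.EndAlg r :=
    { toFun := F
      map_smul' := F.map_smul
      map_zero' := F.map_zero
      map_add' := F.map_add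
      map_mul' := h_comp
      map_star' := h_adj }
  -- A *-homomorphism of C*-algebras is automatically contractive. At `t* ∘ t` this reads `‖G t‖ ^ 2
  -- ≤ ‖t‖ ^ 2`, by the C*-identity on both sides.
  have h1 : ‖F (C.comp (C.adj t) t)‖ ≤ ‖C.comp (C.adj t) t‖ :=
    NonUnitalStarAlgHom.norm_apply_le (F := C.EndAlg a →⋆ₙₐ[ℂ] D.EndAlg r) (A := C.EndAlg a) φ _
  rw [h, D.cstar_identity, C.cstar_identity] at h1
  exact (sq_le_sq₀ (norm_nonneg _) (norm_nonneg _)).1 h1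

end Contractive

/-! ### The topology of the automorphism group -/

section AutTopology

variable {S : SymTensorCStarCat.{v} ℕ}

noncomputable instance (S : TensorCStarCat.{v} ℕ) : NormedSpace ℂ (DRAlg S) where
  norm_smul_le z x := drNorm_le fun A _ φ => by
    rw [map_smul]
    exact (norm_smul_le _ _).trans
      (mul_le_mul_of_nonneg_left (φ.norm_le_drNorm x) (norm_nonneg z))

theorem norm_toDR_le {S : TensorCStarCat.{v} ℕ} {r s : ℕ} (t : S.Hom r s) : ‖toDR t‖ ≤ ‖t‖ := by
  rw [toDR, UniformSpace.Completion.norm_coe]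
  exact drNorm_le fun A _ φ => φ.norm_le t

/-- The embedding of arrows in the Doplicher-Roberts algebra. -/
noncomputable def toDRL {S : TensorCStarCat.{v} ℕ} (r s : ℕ) : S.Hom r s →L[ℂ] DRCompletion S :=
  LinearMap.mkContinuous
    { toFun := toDR
      map_add' t t' := by
        rw [toDR, DRAlg.of_add, UniformSpace.Completion.coe_add]; rfl
      map_smul' z t := by
        rw [toDR, DRAlg.of_smul, UniformSpace.Completion.coe_smul]; rfl } 1
    fun t => by rw [one_mul]; exact norm_toDR_le t

theorem isClosed_intertwiners (S : TensorCStarCat.{v} ℕ) (r s : ℕ) :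
    IsClosed (intertwiners S r s) := by
  simp only [intertwiners, Set.ofPred_forall]
  exact isClosed_iInter fun a =>
    isClosed_eq (continuous_id.mul continuous_const) (continuous_const.mul continuous_id)

/-- Amenability makes the map injective with range the intertwiner space, which is closed. The open
mapping theorem then bounds it below. This is the only place where amenability is unfolded. -/
theorem Amenable.isEmbedding_toDR {S : TensorCStarCat.{v} ℕ} (hS : Amenable S) (r s : ℕ) :
    IsEmbedding (toDR : S.Hom r s → DRCompletion S) := by
  have h2 : Function.Injective (toDRL (S := S) r s) := Set.injOn_univ.1 (hS r s).injOn
  have h1 : IsClosed (Set.range (toDRL (S := S) r s)) := by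
    have : Set.range (toDRL (S := S) r s) = intertwiners S r s := by
      rw [← (hS r s).image_eq, Set.image_univ]; rfl
    rw [this]
    exact isClosed_intertwiners S r s
  obtain ⟨K, hK⟩ := (toDRL (S := S) r s).antilipschitz_of_injective_of_isClosed_range h2 h1
  exact (AntilipschitzWith.isUniformEmbedding hK (toDRL (S := S) r s).uniformContinuous).isEmbedding

theorem AutEps.extDR_toDR (α : AutEps S) {r s : ℕ} (t : S.Hom r s) :
    α.extDR (toDR t) = toDR (α.app r s t) := by
  rw [toDR, AutEps.extDR_coe, AutEps.extAlg_of]; rfl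

/-- Continuity on arrows passes to the algebra that they generate, and from this dense subalgebra to
the completion by an `ε / 3` argument, as all the `extDR` are contractions. -/
theorem AutEps.continuous_extDR_of_app {Y : Type*} [TopologicalSpace Y] {g : Y → AutEps S}
    (h : ∀ (r s : ℕ) (t : S.Hom r s), Continuous fun y => (g y).app r s t)
    (x : DRCompletion S.toTensorCStarCat) : Continuous fun y => (g y).extDR x := by
  have h1 : ∀ x : DRAlg S.toTensorCStarCat, Continuous fun y =>
      (((g y).extAlg x : DRAlg S.toTensorCStarCat) : DRCompletion S.toTensorCStarCat) := by
    intro x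
    induction x using DRAlg.induction with
    | h_scalar z => simpa only [AlgHom.commutes] using continuous_const
    | h_of t =>
      simp only [AutEps.extAlg_of]
      exact (toDRL _ _).continuous.comp (h _ _ t)
    | h_mul x y hx hy =>
      simp only [map_mul, UniformSpace.Completion.coe_mul]; exact hx.mul hy
    | h_add x y hx hy =>
      simp only [map_add, UniformSpace.Completion.coe_add]; exact hx.add hy
  rw [continuous_iff_continuousAt]
  intro y
  rw [Metric.continuousAt_iff']
  intro ε hε
  obtain ⟨_, ⟨x', rfl⟩, hx'⟩ := Metric.mem_closure_iff.1
    (UniformSpace.Completion.denseRange_coe (α := DRAlg S.toTensorCStarCat) x) (ε / 3)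
      (by positivity)
  filter_upwards [Metric.continuousAt_iff'.1 (h1 x').continuousAt (ε / 3) (by positivity)]
    with y' hy'
  have h2 : ∀ y, dist ((g y).extDR x) ((g y).extDR x') < ε / 3 := fun y => by
    rw [dist_eq_norm, ← map_sub]
    exact (AutEps.norm_extDR_le _ _).trans_lt (by rwa [← dist_eq_norm])
  rw [← AutEps.extDR_coe, ← AutEps.extDR_coe] at hy'
  have h3 := h2 y'
  have h4 := h2 y
  have h5 := dist_triangle4 ((g y').extDR x) ((g y').extDR x') ((g y).extDR x') ((g y).extDR x)
  rw [dist_comm ((g y).extDR x')] at h5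
  linarith

/-- The topology of the automorphism group is that of pointwise convergence on the arrows. -/
theorem Amenable.continuousOn_iff (hS : Amenable S.toTensorCStarCat) {Y : Type*}
    [TopologicalSpace Y] {g : Y → AutEps S} {s : Set Y} :
    ContinuousOn g s ↔ ∀ (p q : ℕ) (t : S.Hom p q), ContinuousOn (fun y => (g y).app p q t) s := by
  simp only [continuousOn_iff_continuous_domRestrict]
  rw [AutEps.continuous_iff]
  refine ⟨fun h p q t => ?_, fun h x =>
    AutEps.continuous_extDR_of_app (g := s.domRestrict g) h x⟩
  rw [(hS.isEmbedding_toDR p q).continuous_iff]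
  have := h (toDR t)
  simp only [AutEps.extDR_toDR] at this
  exact this

/-- Continuous families of autofunctors map continuous families of arrows to continuous ones. -/
theorem AutEps.continuousWithinAt_app {Y : Type*} [TopologicalSpace Y] {g : Y → AutEps S}
    {p q : ℕ} {σ : Y → S.Hom p q} {s : Set Y} {y : Y}
    (hg : ∀ t, ContinuousWithinAt (fun y => (g y).app p q t) s y)
    (hσ : ContinuousWithinAt σ s y) :
    ContinuousWithinAt (fun y => (g y).app p q (σ y)) s y := by
  rw [ContinuousWithinAt, tendsto_iff_norm_sub_tendsto_zero]
  have h1 : Filter.Tendsto (fun y' => ‖σ y' - σ y‖ + ‖(g y').app p q (σ y) -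
      (g y).app p q (σ y)‖) (𝓝[s] y) (𝓝 (0 + 0)) :=
    (tendsto_iff_norm_sub_tendsto_zero.1 hσ).add (tendsto_iff_norm_sub_tendsto_zero.1 (hg (σ y)))
  rw [add_zero] at h1
  refine squeeze_zero (fun _ => norm_nonneg _) (fun y' => ?_) h1
  -- The first summand has norm `‖σ y' - σ y‖` whatever `y'` is, because autofunctors are isometric.
  have h2 : (g y').app p q (σ y') - (g y).app p q (σ y) = (g y').app p q (σ y' - σ y) +
      ((g y').app p q (σ y) - (g y).app p q (σ y)) := by rw [map_sub]; abel
  rw [h2]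
  exact (norm_add_le _ _).trans (by rw [LinearIsometryEquiv.norm_map])

end AutTopology

/-! ### The action of the scalars -/

section Act

theorem CStarCat.castHom_add {Ob : Type w} (C : CStarCat.{v} Ob) {a a' b b' : Ob} (ha : a = a')
    (hb : b = b') (t s : C.Hom a b) :
    C.castHom ha hb (t + s) = C.castHom ha hb t + C.castHom ha hb s := by
  subst ha hb; rfl

theorem CStarCat.castHom_smul {Ob : Type w} (C : CStarCat.{v} Ob) {a a' b b' : Ob} (ha : a = a')
    (hb : b = b') (z : ℂ) (t : C.Hom a b) :
    C.castHom ha hb (z • t) = z • C.castHom ha hb t := by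
  subst ha hb; rfl

theorem CStarCat.castHom_comp {Ob : Type w} (C : CStarCat.{v} Ob) {a a' b b' c c' : Ob}
    (ha : a = a') (hb : b = b') (hc : c = c') (t' : C.Hom b c) (t : C.Hom a b) :
    C.castHom ha hc (C.comp t' t) = C.comp (C.castHom hb hc t') (C.castHom ha hb t) := by
  subst ha hb hc; rfl

theorem CStarCat.norm_castHom {Ob : Type w} (C : CStarCat.{v} Ob) {a a' b b' : Ob} (ha : a = a')
    (hb : b = b') (t : C.Hom a b) : ‖C.castHom ha hb t‖ = ‖t‖ := by
  subst ha hb; rfl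

namespace SymCatOver

variable {X : Type u} [TopologicalSpace X] (T : SymCatOver.{u, t, w} X) {a b c : T.Ob}

/-- This is the interchange law of `⊗` and `∘`. -/
theorem act_comp (f f' : C(X, ℂ)) (t' : T.cat.Hom b c) (t : T.cat.Hom a b) :
    T.act (f * f') (T.cat.comp t' t) = T.cat.comp (T.act f t') (T.act f' t) := by
  rw [act, T.scal_mul, T.cat.tensor_comp, T.cat.castHom_comp _ (zero_add b)]; rfl

theorem act_one (t : T.cat.Hom a b) : T.act 1 t = t := by
  rw [act, T.scal_one, T.cat.id_zero_tensor]

/-- Inserting an identity arrow on either side reduces this to the interchange law `act_comp`. -/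
theorem act_mul (f f' : C(X, ℂ)) (t : T.cat.Hom a b) :
    T.act (f * f') t = T.act f (T.act f' t) := by
  conv_lhs => rw [← T.cat.id_comp t, T.act_comp]
  conv_rhs => rw [← T.cat.id_comp (T.act f' t), ← mul_one f, T.act_comp, T.act_one]

theorem act_scal_id (f : C(X, ℂ)) : T.act f (T.cat.id 0) = T.scal f :=
  T.cat.tensor_id_zero (T.scal f)

theorem add_act (f f' : C(X, ℂ)) (t : T.cat.Hom a b) :
    T.act (f + f') t = T.act f t + T.act f' t := by
  rw [act, map_add, T.cat.add_tensor, T.cat.castHom_add]; rfl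

theorem zero_act (t : T.cat.Hom a b) : T.act 0 t = 0 := by
  simpa using T.add_act 0 0 t

/-- Multiplication with a scalar function. -/
noncomputable def actL (f : C(X, ℂ)) (a b : T.Ob) : T.cat.Hom a b →L[ℂ] T.cat.Hom a b :=
  LinearMap.mkContinuous
    { toFun := T.act f
      map_add' t s := by rw [act, T.cat.tensor_add, T.cat.castHom_add]; rfl
      map_smul' z t := by rw [act, T.cat.tensor_smul, T.cat.castHom_smul]; rfl } ‖T.scal f‖
    fun t => (T.cat.norm_castHom _ _ _).trans_le (T.cat.norm_tensor_le _ _)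

theorem actL_apply (f : C(X, ℂ)) (t : T.cat.Hom a b) : T.actL f a b t = T.act f t := rfl

theorem sum_act {ι : Type*} (s : Finset ι) (f : ι → C(X, ℂ)) (t : T.cat.Hom a b) :
    T.act (∑ i ∈ s, f i) t = ∑ i ∈ s, T.act (f i) t := by
  classical
  induction s using Finset.induction_on with
  | empty => simpa using T.zero_act t
  | insert i s hi ih => rw [Finset.sum_insert hi, Finset.sum_insert hi, T.add_act, ih]

/-- A continuous linear map annihilating the products `f t`, for `f` vanishing on `W`, annihilates
their closed span. -/
theorem eq_zero_of_mem_vanishing {W : Set X} {E : Type*} [NormedAddCommGroup E] [NormedSpace ℂ E]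
    (F : T.cat.Hom a b →L[ℂ] E)
    (h : ∀ (f : C(X, ℂ)) (t : T.cat.Hom a b), (∀ x ∈ W, f x = 0) → F (T.act f t) = 0)
    {t : T.cat.Hom a b} (ht : t ∈ T.vanishing W a b) : F t = 0 := by
  have h1 : T.vanishing W a b ≤ LinearMap.ker F.toLinearMap := by
    refine Submodule.topologicalClosure_minimal _ ?_ F.isClosed_ker
    rw [Submodule.span_le]
    rintro _ ⟨f, t, hf, rfl⟩
    exact h f t hf
  exact h1 ht

theorem act_mem_vanishing {W : Set X} {f : C(X, ℂ)} (hf : ∀ x ∈ W, f x = 0)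
    (t : T.cat.Hom a b) : T.act f t ∈ T.vanishing W a b :=
  Submodule.le_topologicalClosure _ (Submodule.subset_span ⟨f, t, hf, rfl⟩)

/-- A function with support in `W` annihilates the arrows vanishing on `W`. -/
theorem act_eq_zero_of_mem_vanishing {W : Set X} {f : C(X, ℂ)} (hf : ∀ x ∉ W, f x = 0)
    {t : T.cat.Hom a b} (ht : t ∈ T.vanishing W a b) : T.act f t = 0 := by
  refine T.eq_zero_of_mem_vanishing (T.actL f a b) (fun f' t hf' => ?_) ht
  have : f * f' = 0 := by
    ext x
    by_cases hx : x ∈ W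
    · simp [hf' x hx]
    · simp [hf x hx]
  rw [actL_apply, ← T.act_mul, this, T.zero_act]

end SymCatOver

end Act

/-! ### Functors onto the fibre -/

section Fibre

variable {Ob : Type w} [AddMonoid Ob]

/-- A full *-functor of symmetric tensor C*-categories, given by the bijection `e` on objects. -/
structure FibreFunctor (C : SymTensorCStarCat.{t} Ob) (S : SymTensorCStarCat.{v} ℕ)
    (e : Ob ≃+ ℕ) where
  app : ∀ {a b : Ob} {r s : ℕ}, e a = r → e b = s → (C.Hom a b →ₗ[ℂ] S.Hom r s)
  surj : ∀ {a b : Ob} {r s : ℕ} (hr : e a = r) (hs : e b = s), Function.Surjective (app hr hs)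
  map_id : ∀ {a : Ob} {r : ℕ} (h : e a = r), app h h (C.id a) = S.id r
  map_comp : ∀ {a b c : Ob} {p r s : ℕ} (hp : e a = p) (hr : e b = r) (hs : e c = s)
    (t' : C.Hom b c) (t : C.Hom a b),
    app hp hs (C.comp t' t) = S.comp (app hr hs t') (app hp hr t)
  map_adj : ∀ {a b : Ob} {r s : ℕ} (hr : e a = r) (hs : e b = s) (t : C.Hom a b),
    app hs hr (C.adj t) = S.adj (app hr hs t)
  map_tensor : ∀ {a b a' b' : Ob} {r s r' s' : ℕ} (hr : e a = r) (hs : e b = s)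
    (hr' : e a' = r') (hs' : e b' = s') (t : C.Hom a b) (t' : C.Hom a' b'),
    app (by rw [map_add, hr, hr'] : e (a + a') = r + r')
        (by rw [map_add, hs, hs'] : e (b + b') = s + s') (C.tensor t t') =
      S.tensor (app hr hs t) (app hr' hs' t')
  map_braid : ∀ {a b : Ob} {r s : ℕ} (hr : e a = r) (hs : e b = s),
    app (by rw [map_add, hr, hs] : e (a + b) = r + s) (by rw [map_add, hr, hs] : e (b + a) = s + r)
        (C.braid a b) = S.braid r s

namespace FibreFunctor

variable {C : SymTensorCStarCat.{t} Ob} {S : SymTensorCStarCat.{v} ℕ} {e : Ob ≃+ ℕ}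

/-- Boundedness is not part of the definition, but automatic. It lets evaluations at a point
annihilate the closed span in `SymCatOver.vanishing`, and not just its generators. -/
theorem norm_le (p : FibreFunctor C S e) {a b : Ob} {r s : ℕ} (hr : e a = r) (hs : e b = s)
    (t : C.Hom a b) : ‖p.app hr hs t‖ ≤ ‖t‖ :=
  CStarCat.norm_map_le (C := C.toCStarCat) (D := S.toCStarCat) (p.app hr hr) (p.app hr hs)
    (p.map_comp hr hr hr) (p.map_adj hr hr)
    (fun t => by rw [p.map_comp hr hs hr, p.map_adj]) t

/-- Two functors onto the fibre with the same kernel differ by an autofunctor. -/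
theorem exists_aut (p p' : FibreFunctor C S e)
    (h : ∀ {a b : Ob} {r s : ℕ} (hr : e a = r) (hs : e b = s) (t : C.Hom a b),
      p'.app hr hs t = 0 ↔ p.app hr hs t = 0) :
    ∃ α : AutEps S, ∀ {a b : Ob} {r s : ℕ} (hr : e a = r) (hs : e b = s) (t : C.Hom a b),
      α.app r s (p'.app hr hs t) = p.app hr hs t := by
  -- `A r s` is induced by the common kernel. As `e` is bijective, `e.symm r` and `e.symm s` are the
  -- only objects over `r` and `s`, so one map serves all `a` and `b`. Its functoriality is then
  -- checked on lifts of arrows along `p'`.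
  have h1 : ∀ r s, ∃ A : S.Hom r s ≃ₗ[ℂ] S.Hom r s, ∀ {a b : Ob} (hr : e a = r) (hs : e b = s)
      (t : C.Hom a b), A (p'.app hr hs t) = p.app hr hs t := by
    intro r s
    have hr : e (e.symm r) = r := e.apply_symm_apply r
    have hs : e (e.symm s) = s := e.apply_symm_apply s
    have hker : LinearMap.ker (p'.app hr hs) = LinearMap.ker (p.app hr hs) := by
      ext t
      exact h hr hs t
    refine ⟨((p'.app hr hs).quotKerEquivOfSurjective (p'.surj hr hs)).symm ≪≫ₗ
      Submodule.quotEquivOfEq _ _ hker ≪≫ₗ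
      (p.app hr hs).quotKerEquivOfSurjective (p.surj hr hs), ?_⟩
    intro a b hr' hs' t
    obtain rfl : a = e.symm r := e.eq_symm_apply.2 hr'
    obtain rfl : b = e.symm s := e.eq_symm_apply.2 hs'
    have : ((p'.app hr hs).quotKerEquivOfSurjective (p'.surj hr hs)).symm (p'.app hr hs t) =
        Submodule.Quotient.mk t := by
      rw [LinearEquiv.symm_apply_eq]; rfl
    simp only [LinearEquiv.trans_apply, this]
    rfl
  choose A hA using h1
  have lift : ∀ {r s : ℕ} (v : S.Hom r s),
      ∃ t, p'.app (e.apply_symm_apply r) (e.apply_symm_apply s) t = v := fun v => p'.surj _ _ v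
  have hcomp : ∀ {p r s : ℕ} (v' : S.Hom r s) (v : S.Hom p r),
      A p s (S.comp v' v) = S.comp (A r s v') (A p r v) := by
    intro _ _ _ v' v
    obtain ⟨t', rfl⟩ := lift v'
    obtain ⟨t, rfl⟩ := lift v
    rw [← p'.map_comp, hA, hA, hA, p.map_comp]
  have hadj : ∀ {r s : ℕ} (v : S.Hom r s), A s r (S.adj v) = S.adj (A r s v) := by
    intro _ _ v
    obtain ⟨t, rfl⟩ := lift v
    rw [← p'.map_adj, hA, hA, p.map_adj]
  have hcomp' : ∀ {p r s : ℕ} (v' : S.Hom r s) (v : S.Hom p r),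
      (A p s).symm (S.comp v' v) = S.comp ((A r s).symm v') ((A p r).symm v) := by
    intro _ _ _ v' v
    rw [LinearEquiv.symm_apply_eq, hcomp]; simp
  have hadj' : ∀ {r s : ℕ} (v : S.Hom r s), (A s r).symm (S.adj v) = S.adj ((A r s).symm v) := by
    intro _ _ v
    rw [LinearEquiv.symm_apply_eq, hadj]; simp
  -- `A` and its inverse are both compatible with composition and adjoints, hence both contractive.
  -- So `A` is isometric.
  have hnorm : ∀ {r s : ℕ} (v : S.Hom r s), ‖A r s v‖ ≤ ‖v‖ := fun {r s} v =>
    CStarCat.norm_map_le (C := S.toCStarCat) (D := S.toCStarCat) (A r r).toLinearMap (A r s)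
      hcomp hadj (fun t => by rw [← hadj]; exact hcomp _ _) v
  have hnorm' : ∀ {r s : ℕ} (v : S.Hom r s), ‖(A r s).symm v‖ ≤ ‖v‖ := fun {r s} v =>
    CStarCat.norm_map_le (C := S.toCStarCat) (D := S.toCStarCat) (A r r).symm.toLinearMap
      (A r s).symm hcomp' hadj' (fun t => by rw [← hadj']; exact hcomp' _ _) v
  refine ⟨{
    app r s := ⟨A r s, fun v => (hnorm v).antisymm (by simpa using hnorm' (A r s v))⟩
    map_id r := ?_
    map_comp := hcomp
    map_adj := hadj
    map_tensor := ?_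
    map_braid r s := ?_ }, fun hr hs t => hA _ _ hr hs t⟩
  · change A r r (S.id r) = S.id r
    have h1 := hA r r (e.apply_symm_apply r) (e.apply_symm_apply r) (C.id _)
    rwa [p'.map_id, p.map_id] at h1
  · intro r s r' s' v v'
    change A _ _ (S.tensor v v') = S.tensor (A _ _ v) (A _ _ v')
    obtain ⟨t', rfl⟩ := lift v'
    obtain ⟨t, rfl⟩ := lift v
    rw [← p'.map_tensor, hA, hA, hA, p.map_tensor]
  · change A _ _ (S.braid r s) = S.braid r s
    have hr := e.apply_symm_apply r
    have hs := e.apply_symm_apply s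
    have h1 := hA (r + s) (s + r) (by rw [map_add, hr, hs]) (by rw [map_add, hr, hs])
      (C.braid (e.symm r) (e.symm s))
    rwa [p'.map_braid hr hs, p.map_braid hr hs] at h1

end FibreFunctor

end Fibre

/-! ### Continuous functions with values in a normed space -/

section ContinuousSections

variable {X : Type*} [TopologicalSpace X] {E : Type*} [NormedAddCommGroup E] [NormedSpace ℂ E]

/-- The vector `‖v‖ ^ (-1/2) v`. -/
noncomputable def sqrtPart (v : E) : E := ((√‖v‖ : ℝ) : ℂ)⁻¹ • v

theorem sqrt_smul_sqrtPart (v : E) : ((√‖v‖ : ℝ) : ℂ) • sqrtPart v = v := by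
  rcases eq_or_ne v 0 with rfl | hv
  · simp [sqrtPart]
  · refine smul_inv_smul₀ ?_ v
    simpa [Real.sqrt_eq_zero'] using hv

theorem norm_sqrtPart (v : E) : ‖sqrtPart v‖ = √‖v‖ := by
  rw [sqrtPart, norm_smul, norm_inv, Complex.norm_real, Real.norm_of_nonneg (Real.sqrt_nonneg _),
    inv_mul_eq_div, Real.div_sqrt]

/-- The scalar factor is unbounded near `0`, but the norm of the product is `√‖v‖`, which tends to
`0`. -/
theorem continuous_sqrtPart : Continuous (sqrtPart : E → E) := by
  rw [continuous_iff_continuousAt]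
  intro v
  rcases eq_or_ne v 0 with rfl | hv
  · rw [ContinuousAt, tendsto_iff_norm_sub_tendsto_zero]
    have h : sqrtPart (0 : E) = 0 := by simp [sqrtPart]
    simp only [h, sub_zero, norm_sqrtPart]
    have := (Real.continuous_sqrt.comp (continuous_norm (E := E))).tendsto 0
    simpa [Function.comp_def] using this
  · refine ContinuousAt.smul (ContinuousAt.inv₀ ?_ ?_) continuousAt_id
    · exact (Complex.continuous_ofReal.comp
        (Real.continuous_sqrt.comp (continuous_norm (E := E)))).continuousAt
    · simpa [Real.sqrt_eq_zero'] using hv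

/-- A section over an open set, multiplied with a function supported there, extends by zero. -/
theorem exists_extend_zero {U : Set X} (hU : IsOpen U) (θ : C(X, ℂ)) (hθ : tsupport θ ⊆ U)
    (v : C(U, E)) :
    ∃ τ : C(X, E), (∀ x (hx : x ∈ U), τ x = θ x • v ⟨x, hx⟩) ∧ ∀ x ∉ U, τ x = 0 := by
  classical
  let τ : X → E := fun x => if hx : x ∈ U then θ x • v ⟨x, hx⟩ else 0
  have h1 : ∀ x (hx : x ∈ U), τ x = θ x • v ⟨x, hx⟩ := fun x hx => dif_pos hx
  have h2 : ∀ x ∉ U, τ x = 0 := fun x hx => dif_neg hx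
  refine ⟨⟨τ, continuous_iff_continuousAt.2 fun x => ?_⟩, h1, h2⟩
  by_cases hx : x ∈ U
  · have h3 : ContinuousOn τ U := by
      rw [continuousOn_iff_continuous_domRestrict]
      have : U.domRestrict τ = fun x : U => θ x • v x := funext fun x => h1 x x.2
      rw [this]
      exact (θ.continuous.comp continuous_subtype_val).smul v.continuous
    exact h3.continuousAt (hU.mem_nhds hx)
  -- A point outside `U` has a neighbourhood disjoint from the closed support of `θ`, where `τ` is
  -- zero.
  · have h3 : τ =ᶠ[𝓝 x] fun _ => 0 := by
      filter_upwards [(isClosed_tsupport θ).isOpen_compl.mem_nhds fun h => hx (hθ h)] with y hy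
      by_cases hy' : y ∈ U
      · rw [h1 y hy', image_eq_zero_of_notMem_tsupport hy, zero_smul]
      · exact h2 y hy'
    exact continuousAt_const.congr h3.symm

variable [CompactSpace X] [T2Space X]

/-- These are the square roots of a partition of unity. Squares provide two factors `θ i`: one
localizes a section or an arrow to `U i`, and the other removes what remains uncontrolled outside `U
i`. -/
theorem exists_sq_partition {n : ℕ} (U : Fin n → Set X) (ho : ∀ i, IsOpen (U i))
    (hc : ∀ x, ∃ i, x ∈ U i) :
    ∃ θ : Fin n → C(X, ℂ), ∑ i, θ i * θ i = 1 ∧ ∀ i, tsupport (θ i) ⊆ U i := by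
  obtain ⟨f, hf⟩ := PartitionOfUnity.exists_isSubordinate isClosed_univ U ho
    fun x _ => Set.mem_iUnion.2 (hc x)
  refine ⟨fun i => ⟨fun x => ((√(f i x) : ℝ) : ℂ), by fun_prop⟩, ?_, fun i => ?_⟩
  · ext x
    have h1 : ∑ i, f i x = 1 := by
      rw [← finsum_eq_sum_of_fintype]; exact f.sum_eq_one (Set.mem_univ x)
    simp only [ContinuousMap.coe_sum, ContinuousMap.coe_mul, Finset.sum_apply, Pi.mul_apply,
      ContinuousMap.coe_mk, ContinuousMap.coe_one, Pi.one_apply]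
    rw [← Complex.ofReal_one, ← h1, Complex.ofReal_sum]
    refine Finset.sum_congr rfl fun i _ => ?_
    rw [← Complex.ofReal_mul, Real.mul_self_sqrt (f.nonneg i x)]
  · refine (closure_mono ?_).trans (hf i)
    intro x hx hx'
    exact hx (by simp [hx'])

/-- Urysohn's lemma is applied to an intermediate open `V` with closure in `U`, so that the closed
support, and not only the set where `θ ≠ 0`, lies in `U`. -/
theorem exists_bump {U K : Set X} (hU : IsOpen U) (hK : IsClosed K) (hKU : K ⊆ U) :
    ∃ θ : C(X, ℂ), tsupport θ ⊆ U ∧ ∀ x ∈ K, θ x = 1 := by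
  obtain ⟨V, hV, hKV, hVU⟩ := normal_exists_closure_subset hK hU hKU
  obtain ⟨f, h0, h1, -⟩ := exists_continuous_zero_one_of_isClosed hV.isClosed_compl hK
    (Set.disjoint_compl_left_iff_subset.2 hKV)
  refine ⟨⟨fun x => (f x : ℂ), by fun_prop⟩, (closure_mono ?_).trans hVU, fun x hx => ?_⟩
  · intro x hx
    by_contra hx'
    exact hx (by simpa using h0 hx')
  · simpa using h1 hx

/-- A continuous function vanishing at a point of a closed set is a product of a scalar function
vanishing at that point, and a continuous function. -/
theorem exists_factor {W : Set X} (hW : IsClosed W) (σ : C(W, E)) :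
    ∃ (f : C(X, ℂ)) (σ' : C(W, E)), (∀ y : W, σ y = f y • σ' y) ∧ ∀ y : W, σ y = 0 → f y = 0 := by
  -- The scalar factor is `√‖σ‖`, extended from `W` to `X` by Tietze's theorem.
  obtain ⟨f, hf⟩ := ContinuousMap.exists_restrict_eq hW
    ⟨fun y : W => ((√‖σ y‖ : ℝ) : ℂ), by fun_prop⟩
  have hf' : ∀ y : W, f y = ((√‖σ y‖ : ℝ) : ℂ) := fun y => DFunLike.congr_fun hf y
  refine ⟨f, ⟨fun y => sqrtPart (σ y), continuous_sqrtPart.comp σ.continuous⟩, fun y => ?_,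
    fun y hy => ?_⟩
  · rw [hf' y]; exact (sqrt_smul_sqrtPart _).symm
  · rw [hf' y, hy]; simp

end ContinuousSections

/-! ### Local charts and their transition functions -/

section Charts

variable {X : Type u} [TopologicalSpace X] {T : SymCatOver.{u, t, w} X}
  {S : SymTensorCStarCat.{v} ℕ} {e : T.Ob ≃+ ℕ} {W W' : Set X}

theorem LocallyTrivial.nonempty_chartSystem [CompactSpace X] (h : LocallyTrivial T S) :
    Nonempty (ChartSystem T S) := by
  obtain ⟨e, h⟩ := h
  choose W hc hn hW using h
  obtain ⟨s, hs⟩ := CompactSpace.elim_nhds_subcover (fun x => interior (W x))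
    fun x => interior_mem_nhds.2 (hn x)
  refine ⟨⟨e, s.card, fun i => W (s.equivFin.symm i), fun i => hc _, fun x => ?_,
    fun i => (hW _).some⟩⟩
  have hx : x ∈ ⋃ y ∈ s, interior (W y) := hs ▸ Set.mem_univ x
  simp only [Set.mem_iUnion] at hx
  obtain ⟨y, hy, hxy⟩ := hx
  exact ⟨s.equivFin ⟨y, hy⟩, by simpa using hxy⟩

namespace LocalChart

/-- The section over `W` given by an arrow. -/
noncomputable def sec (π : LocalChart T S e W) {a b : T.Ob} {r s : ℕ} (hr : e a = r)
    (hs : e b = s) : T.cat.Hom a b →ₗ[ℂ] C(W, S.Hom r s) :=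
  (π.app hr hs).toLinearMap ∘ₗ (T.vanishing W a b).mkQ

theorem sec_apply (π : LocalChart T S e W) {a b : T.Ob} {r s : ℕ} (hr : e a = r)
    (hs : e b = s) (t : T.cat.Hom a b) : π.sec hr hs t = π.app hr hs (T.restr W t) := rfl

theorem sec_surjective (π : LocalChart T S e W) {a b : T.Ob} {r s : ℕ} (hr : e a = r)
    (hs : e b = s) : Function.Surjective (π.sec hr hs) :=
  (π.app hr hs).surjective.comp (Submodule.mkQ_surjective _)

theorem sec_eq_zero (π : LocalChart T S e W) {a b : T.Ob} {r s : ℕ} (hr : e a = r)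
    (hs : e b = s) {t : T.cat.Hom a b} : π.sec hr hs t = 0 ↔ t ∈ T.vanishing W a b := by
  rw [sec_apply, (π.app hr hs).map_eq_zero_iff]
  exact Submodule.Quotient.mk_eq_zero _

theorem sec_act (π : LocalChart T S e W) {a b : T.Ob} {r s : ℕ} (hr : e a = r)
    (hs : e b = s) (f : C(X, ℂ)) (t : T.cat.Hom a b) (x : W) :
    π.sec hr hs (T.act f t) x = f x • π.sec hr hs t x := π.map_act hr hs f t x

/-- The evaluation of a chart at a point. -/
noncomputable def fibre (π : LocalChart T S e W) (x : W) : FibreFunctor T.cat S e where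
  app hr hs :=
    { toFun t := π.sec hr hs t x
      map_add' t t' := by rw [map_add]; rfl
      map_smul' z t := by rw [map_smul]; rfl }
  surj hr hs v := by
    obtain ⟨t, ht⟩ := π.sec_surjective hr hs (ContinuousMap.const W v)
    exact ⟨t, DFunLike.congr_fun ht x⟩
  map_id h := π.map_id h x
  map_comp hp hr hs t' t := π.map_comp hp hr hs t' t x
  map_adj hr hs t := π.map_adj hr hs t x
  map_tensor hr hs hr' hs' t t' := π.map_tensor hr hs hr' hs' t t' x
  map_braid hr hs := π.map_braid hr hs x

theorem fibre_app (π : LocalChart T S e W) (x : W) {a b : T.Ob} {r s : ℕ} (hr : e a = r)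
    (hs : e b = s) (t : T.cat.Hom a b) : (π.fibre x).app hr hs t = π.sec hr hs t x := rfl

variable [CompactSpace X] [T2Space X]

/-- Up to an arrow vanishing on `W`, which the other chart annihilates at `x ∈ W`, the arrow `t` is
a product `f t'` with `f x = 0`. The other chart maps this product to `0` at `x` by
`C(X)`-linearity. Hence the kernel of the evaluation at `x` does not depend on the chart. -/
theorem sec_eq_zero_of_sec_eq_zero (hW : IsClosed W) (π : LocalChart T S e W)
    (π' : LocalChart T S e W') {x : X} (hx : x ∈ W) (hx' : x ∈ W') {a b : T.Ob} {r s : ℕ}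
    (hr : e a = r) (hs : e b = s) {t : T.cat.Hom a b} (h : π.sec hr hs t ⟨x, hx⟩ = 0) :
    π'.sec hr hs t ⟨x, hx'⟩ = 0 := by
  obtain ⟨f, σ', h1, h2⟩ := exists_factor hW (π.sec hr hs t)
  obtain ⟨t', rfl⟩ := π.sec_surjective hr hs σ'
  have h3 : t - T.act f t' ∈ T.vanishing W a b := by
    rw [← π.sec_eq_zero hr hs, map_sub, sub_eq_zero]
    ext y
    rw [h1, sec_act]
  let F : T.cat.Hom a b →L[ℂ] S.Hom r s := LinearMap.mkContinuous ((π'.fibre ⟨x, hx'⟩).app hr hs) 1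
    fun t => by rw [one_mul]; exact FibreFunctor.norm_le _ hr hs t
  have h4 : F (t - T.act f t') = 0 := by
    refine T.eq_zero_of_mem_vanishing F (fun f t hf => ?_) h3
    change π'.sec hr hs (T.act f t) ⟨x, hx'⟩ = 0
    rw [sec_act, hf x hx, zero_smul]
  have h5 : π'.sec hr hs t ⟨x, hx'⟩ - π'.sec hr hs (T.act f t') ⟨x, hx'⟩ = 0 := by
    rw [map_sub] at h4; exact h4
  rw [sec_act, h2 ⟨x, hx⟩ h, zero_smul, sub_zero] at h5
  exact h5

theorem exists_transition (hW : IsClosed W) (hW' : IsClosed W') (π : LocalChart T S e W)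
    (π' : LocalChart T S e W') (x : X) :
    ∃ α : AutEps S, ∀ (hx : x ∈ W) (hx' : x ∈ W') {a b : T.Ob} {r s : ℕ} (hr : e a = r)
      (hs : e b = s) (t : T.cat.Hom a b),
      π.sec hr hs t ⟨x, hx⟩ = α.app r s (π'.sec hr hs t ⟨x, hx'⟩) := by
  by_cases hx : x ∈ W ∧ x ∈ W'
  · obtain ⟨α, hα⟩ := (π.fibre ⟨x, hx.1⟩).exists_aut (π'.fibre ⟨x, hx.2⟩) fun hr hs t =>
      ⟨fun h => sec_eq_zero_of_sec_eq_zero hW' π' π hx.2 hx.1 hr hs h,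
        fun h => sec_eq_zero_of_sec_eq_zero hW π π' hx.1 hx.2 hr hs h⟩
    exact ⟨α, fun _ _ _ _ _ _ hr hs t => (hα hr hs t).symm⟩
  -- Outside the overlap any value will do.
  · exact ⟨1, fun h h' => (hx ⟨h, h'⟩).elim⟩

end LocalChart

variable [CompactSpace X] [T2Space X]

theorem ChartSystem.exists_cocycle (hS : Amenable S.toTensorCStarCat) (P : ChartSystem T S) :
    ∃ c : Cocycle X (AutEps S), IsTransitionCocycle P c := by
  choose g hg using fun i j x => LocalChart.exists_transition (P.isClosed i) (P.isClosed j)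
    (P.chart i) (P.chart j) x
  have hcont : ∀ i j, ContinuousOn (g i j) (P.W i ∩ P.W j) := by
    intro i j
    rw [hS.continuousOn_iff]
    intro p q v
    -- Lift the constant section `v` over `W j` to an arrow `t`. Then `x ↦ g i j x v` is the section
    -- of `t` in chart `i`, which is continuous.
    obtain ⟨t, ht⟩ := (P.chart j).sec_surjective (P.e.apply_symm_apply p)
      (P.e.apply_symm_apply q) (ContinuousMap.const _ v)
    rw [continuousOn_iff_continuous_domRestrict]
    have h1 : (P.W i ∩ P.W j).domRestrict (fun x => (g i j x).app p q v) =
        fun x : ↥(P.W i ∩ P.W j) =>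
        (P.chart i).sec (P.e.apply_symm_apply p) (P.e.apply_symm_apply q) t ⟨x, x.2.1⟩ := by
      funext x
      rw [hg i j x x.2.1 x.2.2, ht]; rfl
    rw [h1]
    fun_prop
  refine ⟨⟨P.n, fun i => interior (P.W i), fun i => isOpen_interior, P.cover, g,
    fun i j => (hcont i j).mono (Set.inter_subset_inter interior_subset interior_subset), ?_⟩,
    rfl, fun i => rfl, fun i j x hi hj _ _ _ _ _ hr hs t => hg i j x hi hj hr hs t⟩
  rintro i j k x ⟨⟨hi, hj⟩, hk⟩
  refine AutEps.ext_app fun {r s} v => ?_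
  -- Every vector of the fibre is the value of some arrow in chart `k`, and on such values both
  -- sides give the value in chart `i`.
  obtain ⟨t, rfl⟩ := ((P.chart k).fibre ⟨x, interior_subset hk⟩).surj
    (P.e.apply_symm_apply r) (P.e.apply_symm_apply s) v
  rw [LocalChart.fibre_app, AutEps.mul_app, ← hg j k x (interior_subset hj),
    ← hg i j x (interior_subset hi), ← hg i k x (interior_subset hi)]

/-- A category with a system of local charts is the glueing along the transition functions. -/
theorem IsTransitionCocycle.nonempty_glueing {P : ChartSystem T S} {c : Cocycle X (AutEps S)}
    (h : IsTransitionCocycle P c) : Nonempty (Glueing T S c) := by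
  have hU : ∀ i, c.U i ⊆ P.W (Fin.cast h.n_eq i) := fun i =>
    (h.U_eq i).subset.trans interior_subset
  have htr : ∀ (i j : Fin c.n) (x : X) (hi : x ∈ c.U i) (hj : x ∈ c.U j) {a b : T.Ob} {r s : ℕ}
      (hr : P.e a = r) (hs : P.e b = s) (t : T.cat.Hom a b),
      (P.chart (Fin.cast h.n_eq i)).sec hr hs t ⟨x, hU i hi⟩ =
        (c.g i j x).app r s ((P.chart (Fin.cast h.n_eq j)).sec hr hs t ⟨x, hU j hj⟩) :=
    fun i j x hi hj _ _ _ _ hr hs t => h.transition i j x _ _ ⟨hi, hj⟩ hr hs t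
  obtain ⟨θ, hθ, hθU⟩ := exists_sq_partition c.U c.isOpen c.cover
  have hθ0 : ∀ i, ∀ x ∉ c.U i, θ i x = 0 := fun i x hx =>
    image_eq_zero_of_notMem_tsupport fun hx' => hx (hθU i hx')
  refine ⟨{
    e := P.e
    π i _ _ _ _ hr hs :=
      { toFun t := ((P.chart (Fin.cast h.n_eq i)).sec hr hs t).comp
          ⟨Set.inclusion (hU i), continuous_inclusion (hU i)⟩
        map_add' t t' := by rw [map_add]; rfl
        map_smul' z t := by rw [map_smul]; rfl }
    glue i j x hi hj _ _ _ _ hr hs t := htr i j x hi hj hr hs t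
    existsUnique := ?_
    map_id i _ _ h _ := (P.chart _).map_id h _
    map_comp i _ _ _ _ _ _ hp hr hs t' t _ := (P.chart _).map_comp hp hr hs t' t _
    map_adj i _ _ _ _ hr hs t _ := (P.chart _).map_adj hr hs t _
    map_scal i f x := ?_
    map_tensor i _ _ _ _ _ _ _ _ hr hs hr' hs' t t' _ :=
      (P.chart _).map_tensor hr hs hr' hs' t t' _
    map_braid i _ _ _ _ hr hs _ := (P.chart _).map_braid hr hs _ }⟩
  · intro a b r s hr hs v hv
    refine existsUnique_of_exists_of_unique ?_ ?_
    -- Extend `θ i • v i` by zero to `τ i`, and lift its restriction to the closed set of chart `i`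
    -- to an arrow `t i`. At `x ∈ U j` chart `j` maps `θ i • t i` to `θ i x ^ 2 • v j x`; if `x ∉ U
    -- i`, the outer factor `θ i` makes this true whatever `t i` is there. The squares sum to `1`.
    · choose τ hτ hτ0 using fun i => exists_extend_zero (c.isOpen i) (θ i) (hθU i) (v i)
      choose t ht using fun i => (P.chart (Fin.cast h.n_eq i)).sec_surjective hr hs
        ((τ i).comp ⟨Subtype.val, continuous_subtype_val⟩)
      refine ⟨∑ i, T.act (θ i) (t i), fun j => ?_⟩
      ext x
      change (P.chart _).sec hr hs (∑ i, T.act (θ i) (t i)) ⟨x, hU j x.2⟩ = v j x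
      have h1 : ∀ i, (P.chart (Fin.cast h.n_eq j)).sec hr hs (T.act (θ i) (t i))
          ⟨x, hU j x.2⟩ = (θ i * θ i) x.1 • v j x := by
        intro i
        rw [LocalChart.sec_act]
        by_cases hx : x.1 ∈ c.U i
        · rw [htr j i x x.2 hx, ht]
          change θ i x.1 • (c.g j i x).app r s (τ i x.1) = _
          rw [hτ i x hx, map_smul, ← hv j i x x.2 hx, smul_smul]; rfl
        · simp [hθ0 i x hx]
      rw [map_sum, ContinuousMap.sum_apply, Finset.sum_congr rfl fun i _ => h1 i,
        ← Finset.sum_smul, ← ContinuousMap.sum_apply, hθ]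
      simp
    · intro t t' h1 h2
      -- One factor `θ i` makes the section of `t - t'` zero on all of the closed chart domain, also
      -- outside `U i`, so that `θ i • (t - t')` lies in the vanishing subspace. The other factor,
      -- being supported in that domain, annihilates it.
      rw [← sub_eq_zero, ← T.act_one (t - t'), ← hθ, T.sum_act]
      refine Finset.sum_eq_zero fun i _ => ?_
      rw [T.act_mul]
      refine T.act_eq_zero_of_mem_vanishing (fun x hx => hθ0 i x fun hx' => hx (hU i hx'))
        (((P.chart (Fin.cast h.n_eq i)).sec_eq_zero hr hs).1 ?_)
      ext x
      rw [LocalChart.sec_act]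
      by_cases hx : x.1 ∈ c.U i
      · have h3 : (P.chart (Fin.cast h.n_eq i)).sec hr hs t x =
            (P.chart (Fin.cast h.n_eq i)).sec hr hs t' x :=
          DFunLike.congr_fun ((h1 i).trans (h2 i).symm) ⟨x.1, hx⟩
        rw [map_sub, ContinuousMap.sub_apply, h3, sub_self, smul_zero]; rfl
      · rw [hθ0 i x hx, zero_smul]; rfl
  · change (P.chart _).sec _ _ (T.scal f) ⟨x, hU i x.2⟩ = _
    rw [← T.act_scal_id, LocalChart.sec_act]
    exact congrArg _ ((P.chart _).map_id _ _)

end Charts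

/-! ### Sections along a cocycle -/

/-- This serves for functions on `X` patched from the members of a family by choosing a member at
each point: near a given point they agree with one fixed member. -/
theorem continuousAt_of_eventually_eq {X E : Type*} [TopologicalSpace X] [TopologicalSpace E]
    {U : Set X} (hU : IsOpen U) {x : X} (hx : x ∈ U) (v : C(U, E)) {f : X → E}
    (h : ∀ᶠ y in 𝓝 x, ∀ hy : y ∈ U, f y = v ⟨y, hy⟩) : ContinuousAt f x := by
  rw [← hU.isOpenEmbedding_subtypeVal.continuousAt_iff (x := ⟨x, hx⟩)]
  refine v.continuous.continuousAt.congr ?_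
  filter_upwards [continuous_subtype_val.continuousAt.eventually h] with y hy
  exact (hy y.2).symm

section Sections

variable {X : Type u} [TopologicalSpace X] {S : SymTensorCStarCat.{v} ℕ}

/-- The compatible families of continuous sections of the trivial bundles over the sets `U i`. -/
def Cocycle.sections (c : Cocycle X (AutEps S)) (r s : ℕ) :
    Submodule ℂ (∀ i, C(c.U i, S.Hom r s)) where
  carrier := {v | ∀ (i j : Fin c.n) (x : X) (hi : x ∈ c.U i) (hj : x ∈ c.U j),
    v i ⟨x, hi⟩ = (c.g i j x).app r s (v j ⟨x, hj⟩)}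
  add_mem' {v v'} hv hv' i j x hi hj := by
    simp only [Pi.add_apply, ContinuousMap.add_apply, map_add]
    rw [hv i j x hi hj, hv' i j x hi hj]
  zero_mem' i j x hi hj := by simp
  smul_mem' z v hv i j x hi hj := by
    simp only [Pi.smul_apply, ContinuousMap.smul_apply, map_smul]
    rw [hv i j x hi hj]

variable {c : Cocycle X (AutEps S)} {r s : ℕ}

theorem Cocycle.sections_compat (v : c.sections r s) (i j : Fin c.n) (x : X) (hi : x ∈ c.U i)
    (hj : x ∈ c.U j) : v.1 i ⟨x, hi⟩ = (c.g i j x).app r s (v.1 j ⟨x, hj⟩) := v.2 i j x hi hj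

/-- The transition functions are isometric, so the norm at a point does not depend on the member. -/
theorem Cocycle.sections_exists_norm (v : c.sections r s) :
    ∃ N : C(X, ℝ), ∀ i (x : c.U i), N x = ‖v.1 i x‖ := by
  choose k hk using c.cover
  have h1 : ∀ i (x : c.U i), ‖v.1 (k x) ⟨x, hk x⟩‖ = ‖v.1 i x‖ := fun i x => by
    rw [Cocycle.sections_compat v (k x) i x (hk x) x.2, LinearIsometryEquiv.norm_map]
  refine ⟨⟨fun x => ‖v.1 (k x) ⟨x, hk x⟩‖, continuous_iff_continuousAt.2 fun x => ?_⟩, h1⟩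
  exact continuousAt_of_eventually_eq (c.isOpen (k x)) (hk x)
    ⟨fun y => ‖v.1 (k x) y‖, by fun_prop⟩ (.of_forall fun y hy => h1 (k x) ⟨y, hy⟩)

/-- Thus the factorization by the square root of the norm respects the compatibility along a
cocycle. -/
theorem AutEps.app_sqrtPart (α : AutEps S) (v : S.Hom r s) :
    α.app r s (sqrtPart v) = sqrtPart (α.app r s v) := by
  rw [sqrtPart, sqrtPart, map_smul, LinearIsometryEquiv.norm_map]

/-- Every section is a product of a section and a scalar function with the same zeros. -/
theorem Cocycle.sections_exists_factor (v : c.sections r s) :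
    ∃ (f : C(X, ℂ)) (v' : c.sections r s), (∀ i (x : c.U i), v.1 i x = f x • v'.1 i x) ∧
      ∀ i (x : c.U i), v.1 i x = 0 → f x = 0 := by
  obtain ⟨N, hN⟩ := Cocycle.sections_exists_norm v
  refine ⟨⟨fun x => ((√(N x) : ℝ) : ℂ), by fun_prop⟩,
    ⟨fun i => ⟨fun x => sqrtPart (v.1 i x), continuous_sqrtPart.comp (v.1 i).continuous⟩,
      fun i j x hi hj => ?_⟩, fun i x => ?_, fun i x hx => ?_⟩
  · change sqrtPart (v.1 i ⟨x, hi⟩) = (c.g i j x).app r s (sqrtPart (v.1 j ⟨x, hj⟩))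
    rw [AutEps.app_sqrtPart, ← Cocycle.sections_compat v]
  · change v.1 i x = ((√(N x) : ℝ) : ℂ) • sqrtPart (v.1 i x)
    rw [hN i x, sqrt_smul_sqrtPart]
  · change ((√(N x) : ℝ) : ℂ) = 0
    rw [hN i x, hx]; simp

/-- A section of the trivial bundle, multiplied with a function supported in `U i`, extends to a
global section. -/
theorem Cocycle.exists_section (hS : Amenable S.toTensorCStarCat) (c : Cocycle X (AutEps S))
    (i : Fin c.n) {θ : C(X, ℂ)} (hθ : tsupport θ ⊆ c.U i) (τ : C(X, S.Hom r s)) :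
    ∃ v : c.sections r s, ∀ x : c.U i, v.1 i x = θ x • τ x := by
  have h0 : ∀ x ∉ c.U i, θ x • τ x = 0 := fun x hx => by
    rw [image_eq_zero_of_notMem_tsupport fun h => hx (hθ h), zero_smul]
  have hcont : ∀ j, ContinuousOn (fun x => (c.g j i x).app r s (θ x • τ x)) (c.U j) := by
    intro j x hxj
    by_cases hx : x ∈ c.U i
    · have h1 := hS.continuousOn_iff.1 (c.continuousOn j i) r s
      have h2 : ContinuousWithinAt (fun x => (c.g j i x).app r s (θ x • τ x)) (c.U j ∩ c.U i) x :=
        AutEps.continuousWithinAt_app (fun t => h1 t x ⟨hxj, hx⟩) (by fun_prop)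
      exact (h2.continuousAt (((c.isOpen j).inter (c.isOpen i)).mem_nhds
        ⟨hxj, hx⟩)).continuousWithinAt
    -- Outside `U i` nothing is known about `g j i`, but its argument is zero near `x`.
    · refine ContinuousAt.continuousWithinAt
        ((continuousAt_const (y := (0 : S.Hom r s))).congr ?_)
      filter_upwards [(isClosed_tsupport θ).isOpen_compl.mem_nhds fun h => hx (hθ h)] with y hy
      rw [image_eq_zero_of_notMem_tsupport hy, zero_smul, map_zero]
  refine ⟨⟨fun j => ⟨_, (continuousOn_iff_continuous_domRestrict.1 (hcont j))⟩,
    fun j k x hj hk => ?_⟩, fun x => ?_⟩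
  · change (c.g j i x).app r s (θ x • τ x) = (c.g j k x).app r s ((c.g k i x).app r s (θ x • τ x))
    by_cases hx : x ∈ c.U i
    · rw [← AutEps.mul_app, c.mul_eq j k i x ⟨⟨hj, hk⟩, hx⟩]
    · rw [h0 x hx]; simp
  · change (c.g i i x).app r s (θ x • τ x) = _
    rw [c.g_self x.2, AutEps.one_app]

/-- Sections with prescribed locally constant value exist because a bump function equal to `1` near
`x` cuts off the constant. They take the place of constant sections when maps into `K` are tested
for continuity. -/
theorem Cocycle.exists_section_const [CompactSpace X] [T2Space X]
    (hS : Amenable S.toTensorCStarCat) (c : Cocycle X (AutEps S)) (i : Fin c.n) (x : c.U i)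
    (w : S.Hom r s) :
    ∃ v : c.sections r s, ∀ᶠ y in 𝓝 x.1, ∀ hy : y ∈ c.U i, v.1 i ⟨y, hy⟩ = w := by
  obtain ⟨K, hK, hKc, hKU⟩ := exists_mem_nhds_isClosed_subset ((c.isOpen i).mem_nhds x.2)
  obtain ⟨θ, hθ, hθ1⟩ := exists_bump (c.isOpen i) hKc hKU
  obtain ⟨v, hv⟩ := c.exists_section hS i hθ (ContinuousMap.const X w)
  refine ⟨v, ?_⟩
  filter_upwards [hK] with y hy hy'
  rw [hv ⟨y, hy'⟩, hθ1 y hy, one_smul]; rfl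

/-- Sections along equivalent cocycles correspond to each other. -/
theorem Cocycle.exists_transfer (hS : Amenable S.toTensorCStarCat) {c c' : Cocycle X (AutEps S)}
    {u : Fin c.n → Fin c'.n → X → AutEps S} (hu : ∀ i l, ContinuousOn (u i l) (c.U i ∩ c'.U l))
    (h : ∀ i j l m, ∀ x ∈ (c.U i ∩ c.U j) ∩ (c'.U l ∩ c'.U m),
      c.g i j x * u j m x = u i l x * c'.g l m x) (v' : c'.sections r s) :
    ∃ v : c.sections r s, ∀ i l x (hi : x ∈ c.U i) (hl : x ∈ c'.U l),
      v.1 i ⟨x, hi⟩ = (u i l x).app r s (v'.1 l ⟨x, hl⟩) := by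
  choose k hk using c'.cover
  -- The value does not depend on the member `l`: this makes the pointwise choice `k x` harmless and
  -- allows it to be frozen near a point.
  have h1 : ∀ i l x (_ : x ∈ c.U i) (hl : x ∈ c'.U l),
      (u i (k x) x).app r s (v'.1 (k x) ⟨x, hk x⟩) = (u i l x).app r s (v'.1 l ⟨x, hl⟩) := by
    intro i l x hi hl
    have h2 := h i i l (k x) x ⟨⟨hi, hi⟩, hl, hk x⟩
    rw [c.g_self hi, one_mul] at h2
    rw [h2, AutEps.mul_app, ← Cocycle.sections_compat v' l (k x) x hl (hk x)]
  have hcont : ∀ i, ContinuousOn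
      (fun x => (u i (k x) x).app r s (v'.1 (k x) ⟨x, hk x⟩)) (c.U i) := by
    intro i x hx
    have hop : c.U i ∩ c'.U (k x) ∈ 𝓝 x := ((c.isOpen i).inter (c'.isOpen _)).mem_nhds ⟨hx, hk x⟩
    classical
    -- The value `0` off `U' (k x)` only makes the function total; continuity is needed within the
    -- open set alone.
    let σ : X → S.Hom r s := fun y =>
      if hy : y ∈ c'.U (k x) then v'.1 (k x) ⟨y, hy⟩ else 0
    have hσ : ∀ y (hy : y ∈ c'.U (k x)), σ y = v'.1 (k x) ⟨y, hy⟩ := fun y hy => dif_pos hy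
    have h3 : ContinuousWithinAt (fun y => (u i (k x) y).app r s (σ y)) (c.U i ∩ c'.U (k x)) x :=
      AutEps.continuousWithinAt_app
        (fun t => hS.continuousOn_iff.1 (hu i (k x)) r s t x ⟨hx, hk x⟩)
        (continuousAt_of_eventually_eq (c'.isOpen (k x)) (hk x) (v'.1 (k x))
          (.of_forall hσ)).continuousWithinAt
    refine ((h3.continuousAt hop).congr ?_).continuousWithinAt
    filter_upwards [hop] with y hy
    rw [hσ y hy.2, h1 i (k x) y hy.1 hy.2]
  refine ⟨⟨fun i => ⟨_, continuousOn_iff_continuous_domRestrict.1 (hcont i)⟩,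
    fun i j x hi hj => ?_⟩, h1⟩
  change (u i (k x) x).app r s (v'.1 (k x) ⟨x, hk x⟩) =
    (c.g i j x).app r s ((u j (k x) x).app r s (v'.1 (k x) ⟨x, hk x⟩))
  rw [← AutEps.mul_app, h i j (k x) (k x) x ⟨⟨hi, hj⟩, hk x, hk x⟩, c'.g_self (hk x), mul_one]

end Sections

/-! ### Glueings -/

section Glueings

/-- An additive automorphism of `ℕ` fixes the generator `1`, as `1` is a multiple of its image.
Hence two glueings of the same category agree on objects. -/
theorem addEquiv_nat_unique {M : Type*} [AddMonoid M] (e e' : M ≃+ ℕ) : e = e' := by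
  have h : ∀ φ : ℕ ≃+ ℕ, ∀ n, φ n = n := by
    intro φ n
    have h1 : ∀ n, φ n = n * φ 1 := fun n => by
      have := map_nsmul φ n 1
      simpa using this
    obtain ⟨m, hm⟩ := φ.surjective 1
    rw [h1, Nat.eq_one_of_mul_eq_one_left ((h1 m).symm.trans hm), mul_one]
  ext m
  simpa using (h (e'.symm.trans e) (e' m))

variable {X : Type u} [TopologicalSpace X] {S : SymTensorCStarCat.{v} ℕ}
  {T : SymCatOver.{u, t, w} X} {T' : SymCatOver.{u, t, w'} X} {c c' : Cocycle X (AutEps S)}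

namespace Glueing

variable {a b : T.Ob} {r s : ℕ}

/-- The arrows of a glueing are the sections along the cocycle. -/
noncomputable def equiv (G : Glueing T S c) (hr : G.e a = r) (hs : G.e b = s) :
    T.cat.Hom a b ≃ₗ[ℂ] c.sections r s :=
  LinearEquiv.ofBijective
    ((LinearMap.pi fun i => G.π i hr hs).codRestrict (c.sections r s)
      fun t i j x hi hj => G.glue i j x hi hj hr hs t) <| by
    refine ⟨fun t t' h => ?_, fun v => ?_⟩
    · exact (G.existsUnique hr hs (fun i => G.π i hr hs t)
        fun i j x hi hj => G.glue i j x hi hj hr hs t).unique (fun _ => rfl)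
        fun i => (congrFun (congrArg Subtype.val h) i).symm
    · obtain ⟨t, ht, -⟩ := G.existsUnique hr hs v.1 v.2
      exact ⟨t, Subtype.ext (funext ht)⟩

theorem equiv_apply (G : Glueing T S c) (hr : G.e a = r) (hs : G.e b = s) (t : T.cat.Hom a b)
    (i : Fin c.n) : (G.equiv hr hs t).1 i = G.π i hr hs t := rfl

theorem π_equiv_symm (G : Glueing T S c) (hr : G.e a = r) (hs : G.e b = s)
    (v : c.sections r s) (i : Fin c.n) : G.π i hr hs ((G.equiv hr hs).symm v) = v.1 i := by
  rw [← equiv_apply, LinearEquiv.apply_symm_apply]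

theorem hom_ext (G : Glueing T S c) (hr : G.e a = r) (hs : G.e b = s) {t t' : T.cat.Hom a b}
    (h : ∀ i (x : c.U i), G.π i hr hs t x = G.π i hr hs t' x) : t = t' :=
  (G.equiv hr hs).injective (Subtype.ext (funext fun i => ContinuousMap.ext (h i)))

theorem π_act (G : Glueing T S c) (i : Fin c.n) (hr : G.e a = r) (hs : G.e b = s) (f : C(X, ℂ))
    (t : T.cat.Hom a b) (x : c.U i) : G.π i hr hs (T.act f t) x = f x • G.π i hr hs t x := by
  -- The projections commute with transport along equalities of objects, which occurs in the
  -- definition of `act`.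
  have h1 : ∀ {a₀ b₀ : T.Ob} {r₀ s₀ : ℕ} (ha : a₀ = a) (hb : b₀ = b) (hr₀ : G.e a₀ = r₀)
      (hs₀ : G.e b₀ = s₀) (k : r₀ = r) (l : s₀ = s) (t : T.cat.Hom a₀ b₀),
      G.π i hr hs (T.cat.castHom ha hb t) x = S.castHom k l (G.π i hr₀ hs₀ t x) := by
    intro a₀ b₀ r₀ s₀ ha hb hr₀ hs₀ k l t
    subst ha hb k l; rfl
  rw [SymCatOver.act, h1 _ _ (by rw [map_add, map_zero, hr]) (by rw [map_add, map_zero, hs])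
    (zero_add r) (zero_add s), G.map_tensor i (map_zero G.e) (map_zero G.e) hr hs, G.map_scal,
    S.smul_tensor, S.castHom_smul, S.id_zero_tensor]

/-- An arrow vanishing at a point is a multiple of a function vanishing there. -/
theorem exists_factor (G : Glueing T S c) (hr : G.e a = r) (hs : G.e b = s)
    (t : T.cat.Hom a b) :
    ∃ (f : C(X, ℂ)) (t' : T.cat.Hom a b), t = T.act f t' ∧
      ∀ i (x : c.U i), G.π i hr hs t x = 0 → f x = 0 := by
  obtain ⟨f, v', h1, h2⟩ := Cocycle.sections_exists_factor (G.equiv hr hs t)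
  refine ⟨f, (G.equiv hr hs).symm v', G.hom_ext hr hs fun i x => ?_, h2⟩
  rw [π_act, π_equiv_symm]
  exact h1 i x

/-- By `exists_factor` the arrow is a scalar function vanishing at `x` times another arrow, a
description independent of the glueing. So evaluations at `x` in two glueings have the same kernel.
-/
theorem π_eq_zero_of_π_eq_zero (G : Glueing T S c) (G' : Glueing T S c') {i : Fin c.n}
    {l : Fin c'.n} {x : X} (hi : x ∈ c.U i) (hl : x ∈ c'.U l) (hr : G.e a = r) (hs : G.e b = s)
    (hr' : G'.e a = r) (hs' : G'.e b = s) {t : T.cat.Hom a b} (h : G.π i hr hs t ⟨x, hi⟩ = 0) :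
    G'.π l hr' hs' t ⟨x, hl⟩ = 0 := by
  obtain ⟨f, t', rfl, hf⟩ := G.exists_factor hr hs t
  rw [π_act, hf i ⟨x, hi⟩ h, zero_smul]

/-- Transport of a glueing along an isomorphism. -/
noncomputable def comap (F : T.Iso T') (G : Glueing T' S c) : Glueing T S c where
  e := F.e.trans G.e
  π i _ _ _ _ hr hs := G.π i hr hs ∘ₗ (F.app rfl rfl).toLinearMap
  glue i j x hi hj _ _ _ _ hr hs t := G.glue i j x hi hj hr hs (F.app rfl rfl t)
  existsUnique hr hs v hv := by
    obtain ⟨t, ht, hu⟩ := G.existsUnique hr hs v hv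
    refine ⟨(F.app rfl rfl).symm t, fun i => ?_, fun t' ht' => ?_⟩
    · simpa using ht i
    · rw [LinearEquiv.eq_symm_apply]
      exact hu _ ht'
  map_id i a r h x := by
    replace h : G.e (F.e a) = r := h
    change G.π i h h (F.app rfl rfl (T.cat.id _)) x = _
    rw [F.map_id, G.map_id]
  map_comp i _ _ _ _ _ _ hp hr hs t' t x := by
    change G.π i _ _ (F.app rfl rfl (T.cat.comp t' t)) x = _
    rw [F.map_comp rfl rfl rfl, G.map_comp i hp hr hs]; rfl
  map_adj i a b r s hr hs t x := by
    replace hr : G.e (F.e a) = r := hr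
    replace hs : G.e (F.e b) = s := hs
    change G.π i hs hr (F.app rfl rfl (T.cat.adj t)) x = _
    rw [F.map_adj, G.map_adj]; rfl
  map_scal i f x := by
    rw [← G.map_scal i f x, ← F.map_scal f]
    exact comap_aux F G i _ _ _ _ _ _ _ x
  map_tensor i _ _ _ _ _ _ _ _ hr hs hr' hs' t t' x := by
    rw [LinearMap.comp_apply, LinearMap.comp_apply, LinearMap.comp_apply,
      ← G.map_tensor i hr hs hr' hs']
    simp only [LinearEquiv.coe_coe]
    rw [← F.map_tensor rfl rfl rfl rfl]
    exact comap_aux F G i _ _ _ _ _ _ _ x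
  map_braid i a b r s hr hs x := by
    replace hr : G.e (F.e a) = r := hr
    replace hs : G.e (F.e b) = s := hs
    rw [← G.map_braid i hr hs x, ← F.map_braid rfl rfl]
    exact comap_aux F G i _ _ _ _ _ _ _ x
where
  comap_aux (F : T.Iso T') (G : Glueing T' S c) (i : Fin c.n) {a b : T.Ob} {a' b' : T'.Ob}
      {r s : ℕ} (ha : F.e a = a') (hb : F.e b = b') (hr : G.e (F.e a) = r) (hs : G.e (F.e b) = s)
      (hr' : G.e a' = r) (hs' : G.e b' = s) (t : T.cat.Hom a b) (x : c.U i) :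
      G.π i hr hs (F.app rfl rfl t) x = G.π i hr' hs' (F.app ha hb t) x := by
    subst ha hb; rfl

/-- Two glueings along the same cocycle are isomorphic. -/
theorem nonempty_iso (G : Glueing T S c) (G' : Glueing T' S c) : Nonempty (T.Iso T') := by
  have he : ∀ {a : T.Ob} {a' : T'.Ob}, (G.e.trans G'.e.symm) a = a' → G'.e a' = G.e a :=
    fun h => (G'.e.symm_apply_eq.1 h).symm
  -- An arrow goes to the arrow of `T'` with the same family of sections. The axioms are then
  -- checked on the members, where both categories have pointwise operations.
  let app : ∀ {a b : T.Ob} {a' b' : T'.Ob}, (G.e.trans G'.e.symm) a = a' →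
      (G.e.trans G'.e.symm) b = b' → (T.cat.Hom a b ≃ₗ[ℂ] T'.cat.Hom a' b') :=
    fun ha hb => (G.equiv rfl rfl).trans (G'.equiv (he ha) (he hb)).symm
  have happ : ∀ {a b : T.Ob} {a' b' : T'.Ob} (ha : (G.e.trans G'.e.symm) a = a')
      (hb : (G.e.trans G'.e.symm) b = b') {r s : ℕ} (hr : G.e a = r) (hs : G.e b = s)
      (hr' : G'.e a' = r) (hs' : G'.e b' = s) (t : T.cat.Hom a b) (i : Fin c.n) (x : c.U i),
      G'.π i hr' hs' (app ha hb t) x = G.π i hr hs t x := by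
    intro a b a' b' ha hb r s hr hs hr' hs' t i x
    subst hr hs
    exact DFunLike.congr_fun (G'.π_equiv_symm hr' hs' (G.equiv rfl rfl t) i) x
  refine ⟨{
    e := G.e.trans G'.e.symm
    app := app
    map_id h := ?_
    map_comp ha hb hc t' t := ?_
    map_adj ha hb t := ?_
    map_scal f := ?_
    map_tensor ha hb hc hd t s := ?_
    map_braid ha hb := ?_ }⟩
  · refine G'.hom_ext (he h) (he h) fun i x => ?_
    rw [happ h h rfl rfl, G.map_id, G'.map_id]
  · refine G'.hom_ext (he ha) (he hc) fun i x => ?_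
    rw [happ ha hc rfl rfl, G.map_comp i rfl rfl rfl, G'.map_comp i (he ha) (he hb) (he hc),
      happ hb hc rfl rfl, happ ha hb rfl rfl]
  · refine G'.hom_ext (he hb) (he ha) fun i x => ?_
    rw [happ hb ha rfl rfl, G.map_adj, G'.map_adj, happ ha hb rfl rfl]
  · refine G'.hom_ext (map_zero _) (map_zero _) fun i x => ?_
    rw [happ (map_zero _) (map_zero _) (map_zero _) (map_zero _), G.map_scal, G'.map_scal]
  · refine G'.hom_ext (by rw [map_add, he ha, he hc]) (by rw [map_add, he hb, he hd]) fun i x => ?_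
    rw [happ (by rw [map_add, ha, hc]) (by rw [map_add, hb, hd]) (map_add _ _ _) (map_add _ _ _),
      G.map_tensor i rfl rfl rfl rfl,
      G'.map_tensor i (he ha) (he hb) (he hc) (he hd), happ ha hb rfl rfl, happ hc hd rfl rfl]
  · refine G'.hom_ext (by rw [map_add, he ha, he hb]) (by rw [map_add, he ha, he hb]) fun i x => ?_
    rw [happ (by rw [map_add, ha, hb]) (by rw [map_add, ha, hb]) (map_add _ _ _) (map_add _ _ _),
      G.map_braid i rfl rfl,
      G'.map_braid i (he ha) (he hb)]

/-- A glueing along a cocycle is a glueing along every equivalent cocycle. -/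
theorem nonempty_of_equivalent (hS : Amenable S.toTensorCStarCat) (G : Glueing T S c')
    (h : c.Equivalent c') : Nonempty (Glueing T S c) := by
  obtain ⟨u', hu', h'⟩ : c'.Equivalent c := (Cocycle.setoid X (AutEps S)).symm h
  obtain ⟨u, hu, h⟩ := h
  choose tr htr using fun (r s : ℕ) (v : c'.sections r s) => Cocycle.exists_transfer hS hu h v
  choose k hk using c'.cover
  let π : ∀ (i : Fin c.n) {a b : T.Ob} {r s : ℕ}, G.e a = r → G.e b = s →
      T.cat.Hom a b → C(c.U i, S.Hom r s) := fun i _ _ _ _ hr hs t => (tr _ _ (G.equiv hr hs t)).1 i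
  have hπ : ∀ (i : Fin c.n) {a b : T.Ob} {r s : ℕ} (hr : G.e a = r) (hs : G.e b = s)
      (t : T.cat.Hom a b) (x : c.U i), π i hr hs t x =
        (u i (k x) x).app r s (G.π (k x) hr hs t ⟨x, hk x⟩) :=
    fun i _ _ _ _ hr hs t x => htr _ _ (G.equiv hr hs t) i (k x) x x.2 (hk x)
  refine ⟨{
    e := G.e
    π i _ _ _ _ hr hs :=
      { toFun := π i hr hs
        map_add' t t' := ?_
        map_smul' z t := ?_ }
    glue i j x hi hj _ _ _ _ hr hs t := (tr _ _ (G.equiv hr hs t)).2 i j x hi hj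
    existsUnique := ?_
    map_id i _ _ h x := ?_
    map_comp i _ _ _ _ _ _ hp hr hs t' t x := ?_
    map_adj i _ _ _ _ hr hs t x := ?_
    map_scal i f x := ?_
    map_tensor i _ _ _ _ _ _ _ _ hr hs hr' hs' t t' x := ?_
    map_braid i _ _ _ _ hr hs x := ?_ }⟩
  · ext x
    simp only [hπ, map_add, ContinuousMap.add_apply]
  · ext x
    simp only [hπ, map_smul, ContinuousMap.smul_apply, RingHom.id_apply]
  · intro a b r s hr hs v hv
    choose m hm using c.cover
    refine existsUnique_of_exists_of_unique ?_ fun t t' h1 h2 => ?_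
    -- Transfer back along `(u i l)⁻¹`, which is an equivalence in the opposite direction.
    · obtain ⟨v', hv'⟩ := Cocycle.exists_transfer hS (c := c')
        (u := fun l i x => (u i l x)⁻¹) (fun l i => by rw [Set.inter_comm]; exact (hu i l).inv)
        (fun l m i j x hx => by
          have := h i j l m x ⟨hx.2, hx.1⟩
          rw [eq_inv_mul_iff_mul_eq, ← mul_assoc, ← this, mul_inv_cancel_right])
        (⟨v, hv⟩ : c.sections r s)
      refine ⟨(G.equiv hr hs).symm v', fun i => ?_⟩
      ext x
      change π i hr hs _ x = _
      rw [hπ, π_equiv_symm, hv' (k x) i x (hk x) x.2, ← AutEps.mul_app, mul_inv_cancel,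
        AutEps.one_app]
    · have h3 : ∀ i, π i hr hs t = π i hr hs t' := fun i => (h1 i).trans (h2 i).symm
      refine G.hom_ext hr hs fun l x => ?_
      have h4 : ∀ t, π (m x) hr hs t ⟨x, hm x⟩ = (u (m x) l x).app r s (G.π l hr hs t x) :=
        fun t => htr _ _ (G.equiv hr hs t) (m x) l x (hm x) x.2
      apply ((u (m x) l x).app r s).injective
      rw [← h4, ← h4, h3]
  · change π i _ _ _ x = _
    rw [hπ, G.map_id, AutEps.map_id]
  · change π i _ _ _ x = S.comp (π i _ _ _ x) (π i _ _ _ x)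
    rw [hπ, hπ, hπ, G.map_comp _ hp hr hs, AutEps.map_comp]
  · change π i _ _ _ x = S.adj (π i _ _ _ x)
    rw [hπ, hπ, G.map_adj, AutEps.map_adj]
  · change π i _ _ _ x = _
    rw [hπ, G.map_scal, map_smul, AutEps.map_id]
  · change π i _ _ _ x = S.tensor (π i _ _ _ x) (π i _ _ _ x)
    rw [hπ, hπ, hπ, G.map_tensor _ hr hs hr' hs', AutEps.map_tensor]
  · change π i _ _ _ x = _
    rw [hπ, G.map_braid _ hr hs, AutEps.map_braid]

variable [CompactSpace X] [T2Space X]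

theorem exists_arrow_const (hS : Amenable S.toTensorCStarCat) (G : Glueing T S c) (i : Fin c.n)
    (x : c.U i) (hr : G.e a = r) (hs : G.e b = s) (w : S.Hom r s) :
    ∃ t : T.cat.Hom a b, ∀ᶠ y in 𝓝 x.1, ∀ hy : y ∈ c.U i, G.π i hr hs t ⟨y, hy⟩ = w := by
  obtain ⟨v, hv⟩ := c.exists_section_const hS i x w
  refine ⟨(G.equiv hr hs).symm v, ?_⟩
  filter_upwards [hv] with y hy hy'
  rw [π_equiv_symm]
  exact hy hy'

/-- The evaluation of a glueing at a point. -/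
noncomputable def fibre (hS : Amenable S.toTensorCStarCat) (G : Glueing T S c) {e : T.Ob ≃+ ℕ}
    (he : G.e = e) (i : Fin c.n) (x : c.U i) : FibreFunctor T.cat S e where
  app hr hs :=
    { toFun t := G.π i ((DFunLike.congr_fun he _).trans hr) ((DFunLike.congr_fun he _).trans hs) t x
      map_add' t t' := by rw [map_add]; rfl
      map_smul' z t := by rw [map_smul]; rfl }
  surj hr hs w := by
    obtain ⟨t, ht⟩ := G.exists_arrow_const hS i x ((DFunLike.congr_fun he _).trans hr)
      ((DFunLike.congr_fun he _).trans hs) w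
    exact ⟨t, ht.self_of_nhds x.2⟩
  map_id _ := G.map_id i _ x
  map_comp _ _ _ t' t := G.map_comp i _ _ _ t' t x
  map_adj _ _ t := G.map_adj i _ _ t x
  map_tensor hr hs hr' hs' t t' := G.map_tensor i ((DFunLike.congr_fun he _).trans hr)
    ((DFunLike.congr_fun he _).trans hs) ((DFunLike.congr_fun he _).trans hr')
    ((DFunLike.congr_fun he _).trans hs') t t' x
  map_braid hr hs := G.map_braid i ((DFunLike.congr_fun he _).trans hr)
    ((DFunLike.congr_fun he _).trans hs) x

/-- A category is a glueing along equivalent cocycles only. -/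
theorem equivalent (hS : Amenable S.toTensorCStarCat) (G : Glueing T S c)
    (G' : Glueing T S c') : c.Equivalent c' := by
  have he : G'.e = G.e := addEquiv_nat_unique _ _
  -- The two evaluations at `x` have the same kernel and so differ by an autofunctor. Off the
  -- overlap its value is arbitrary.
  have h1 : ∀ i l x, ∃ α : AutEps S, ∀ (hi : x ∈ c.U i) (hl : x ∈ c'.U l) {a b : T.Ob} {r s : ℕ}
      (hr : G.e a = r) (hs : G.e b = s) (hr' : G'.e a = r) (hs' : G'.e b = s)
      (t : T.cat.Hom a b),
      G.π i hr hs t ⟨x, hi⟩ = α.app r s (G'.π l hr' hs' t ⟨x, hl⟩) := by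
    intro i l x
    by_cases hx : x ∈ c.U i ∧ x ∈ c'.U l
    · obtain ⟨α, hα⟩ := (G.fibre hS rfl i ⟨x, hx.1⟩).exists_aut (G'.fibre hS he l ⟨x, hx.2⟩)
        fun hr hs t => ⟨fun h => π_eq_zero_of_π_eq_zero G' G hx.2 hx.1 _ _ hr hs h,
          fun h => π_eq_zero_of_π_eq_zero G G' hx.1 hx.2 hr hs _ _ h⟩
      exact ⟨α, fun _ _ _ _ _ _ hr hs _ _ t => (hα hr hs t).symm⟩
    · exact ⟨1, fun h h' => (hx ⟨h, h'⟩).elim⟩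
  choose u hu using h1
  have hG : ∀ r, G.e (G.e.symm r) = r := G.e.apply_symm_apply
  have hG' : ∀ r, G'.e (G.e.symm r) = r := fun r => by rw [he, hG]
  refine ⟨u, fun i l => ?_, ?_⟩
  · rw [hS.continuousOn_iff]
    rintro p q w x ⟨hi, hl⟩
    -- For an arrow whose `l`-th member in `G'` is constantly `w` near `x`, the function `y ↦ u i l
    -- y w` agrees near `x` with its `i`-th member in `G`.
    obtain ⟨t, ht⟩ := G'.exists_arrow_const hS l ⟨x, hl⟩ (hG' p) (hG' q) w
    refine (continuousAt_of_eventually_eq (c.isOpen i) hi (G.π i (hG p) (hG q) t)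
      ?_).continuousWithinAt
    filter_upwards [ht, (c'.isOpen l).mem_nhds hl] with y hy hyl hyi
    rw [hu i l y hyi hyl (hG p) (hG q) (hG' p) (hG' q), hy hyl]
  · rintro i j l m x ⟨⟨hi, hj⟩, hl, hm⟩
    refine AutEps.ext_app fun {r s} w => ?_
    -- Represent `w` as the value at `x` of an arrow in member `m`. Both sides then send it to the
    -- value of that arrow in member `i` of `G`.
    obtain ⟨t, ht⟩ := G'.exists_arrow_const hS m ⟨x, hm⟩ (hG' r) (hG' s) w
    rw [← ht.self_of_nhds hm, AutEps.mul_app, AutEps.mul_app,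
      ← hu j m x hj hm (hG r) (hG s), ← G.glue i j x hi hj, ← G'.glue l m x hl hm,
      ← hu i l x hi hl (hG r) (hG s)]

end Glueing

end Glueings

/-! ### Extension of Banach space valued functions -/

section Tietze

/-- Compose with the radial retraction onto the ball of radius `R`; for `R = 0` the zero function
serves. -/
theorem exists_truncation {X E : Type*} [TopologicalSpace X] [NormedAddCommGroup E]
    [NormedSpace ℝ E] {W : Set X} (τ : C(X, E)) {R : ℝ} (hR : 0 ≤ R) (h : ∀ y : W, ‖τ y‖ ≤ R) :
    ∃ τ' : C(X, E), (∀ y : W, τ' y = τ y) ∧ ∀ x, ‖τ' x‖ ≤ R := by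
  rcases hR.eq_or_lt with rfl | hR
  · refine ⟨0, fun y => ?_, fun x => by simp⟩
    rw [norm_le_zero_iff.1 (h y)]; rfl
  · have h0 : ∀ x, 0 < max R ‖τ x‖ := fun x => lt_max_of_lt_left hR
    refine ⟨⟨fun x => (R / max R ‖τ x‖) • τ x, ?_⟩, fun y => ?_, fun x => ?_⟩
    · exact (continuous_const.div (continuous_const.max τ.continuous.norm)
        fun x => (h0 x).ne').smul τ.continuous
    · change (R / max R ‖τ y‖) • τ y = τ y
      rw [max_eq_left (h y), div_self hR.ne', one_smul]
    · change ‖(R / max R ‖τ x‖) • τ x‖ ≤ R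
      rw [norm_smul, Real.norm_of_nonneg (by positivity), div_mul_eq_mul_div, div_le_iff₀ (h0 x)]
      exact mul_le_mul_of_nonneg_left (le_max_right _ _) hR.le

variable {X : Type*} [TopologicalSpace X] [CompactSpace X] [T2Space X] {E : Type*}
  [NormedAddCommGroup E] [NormedSpace ℝ E]

/-- Balls are convex, so constants that are locally good approximations can be averaged by a
partition of unity. Off `W` there is no constraint. -/
theorem exists_approx_extension {W : Set X} (hW : IsClosed W) (σ : C(W, E)) {ε : ℝ} (hε : 0 < ε) :
    ∃ τ : C(X, E), ∀ y : W, dist (σ y) (τ y) < ε := by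
  classical
  obtain ⟨τ, hτ⟩ := exists_continuous_forall_mem_convex_of_local_const
    (t := fun x : X => if hx : x ∈ W then Metric.ball (σ ⟨x, hx⟩) ε else Set.univ)
    (fun x => by
      split_ifs
      · exact convex_ball _ _
      · exact convex_univ)
    (fun x => by
      by_cases hx : x ∈ W
      · refine ⟨σ ⟨x, hx⟩, ?_⟩
        have h1 : ∀ᶠ y : W in 𝓝 ⟨x, hx⟩, dist (σ y) (σ ⟨x, hx⟩) < ε :=
          Metric.continuousAt_iff'.1 σ.continuous.continuousAt ε hε
        rw [nhds_subtype_eq_comap, Filter.eventually_comap] at h1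
        filter_upwards [h1] with y hy
        split_ifs with hyW
        · exact Metric.mem_ball'.2 (hy ⟨y, hyW⟩ rfl)
        · trivial
      · refine ⟨0, ?_⟩
        filter_upwards [hW.isOpen_compl.mem_nhds hx] with y hy
        rw [dif_neg hy]
        trivial)
  refine ⟨τ, fun y => ?_⟩
  have h1 := hτ y
  rw [dif_pos y.2] at h1
  exact Metric.mem_ball'.1 h1

/-- The Tietze extension theorem for functions on closed subsets of a compact Hausdorff space with
values in a Banach space. -/
theorem exists_banach_extension [CompleteSpace E] {W : Set X} (hW : IsClosed W) (σ : C(W, E)) :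
    ∃ τ : C(X, E), ∀ y : W, τ y = σ y := by
  have : CompactSpace W := isCompact_iff_compactSpace.1 hW.isCompact
  let f : NormedAddGroupHom C(X, E) C(W, E) :=
    AddMonoidHom.mkNormedAddGroupHom
      { toFun τ := τ.restrict W
        map_zero' := rfl
        map_add' _ _ := rfl } 1 fun τ => by
        rw [one_mul, ContinuousMap.norm_le _ (norm_nonneg _)]
        exact fun y => τ.norm_coe_le_norm y
  have hf : ∀ τ (y : W), f τ y = τ y := fun _ _ => rfl
  -- Truncation makes the restriction map attain every element of its range with no increase of
  -- norm. This control, together with density of the range and completeness, gives surjectivity by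
  -- successive approximation.
  have h1 : f.SurjectiveOnWith f.range 1 := by
    rintro _ ⟨τ, rfl⟩
    change ∃ g, f g = f τ ∧ ‖g‖ ≤ 1 * ‖f τ‖
    obtain ⟨τ', h2, h3⟩ := exists_truncation (W := W) τ (norm_nonneg (f τ))
      fun y => (f τ).norm_coe_le_norm y
    refine ⟨τ', ContinuousMap.ext h2, ?_⟩
    rw [one_mul, ContinuousMap.norm_le _ (norm_nonneg _)]
    exact h3
  have h2 : σ ∈ f.range.topologicalClosure := by
    refine Metric.mem_closure_iff.2 fun ε hε => ?_
    obtain ⟨τ, hτ⟩ := exists_approx_extension hW σ hε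
    refine ⟨f τ, ⟨τ, rfl⟩, ?_⟩
    rw [ContinuousMap.dist_lt_iff hε]
    exact hτ
  obtain ⟨τ, hτ, -⟩ := controlled_closure_of_complete one_pos one_pos h1 σ h2
  exact ⟨τ, fun y => by rw [← hτ, hf]⟩

end Tietze

/-! ### Glueings are locally trivial -/

section Charts

variable {X : Type u} [TopologicalSpace X] [CompactSpace X] [T2Space X]
  {S : SymTensorCStarCat.{v} ℕ} {T : SymCatOver.{u, t, w} X} {c : Cocycle X (AutEps S)}

namespace Glueing

/-- The members of the families, restricted to a subset. -/
noncomputable def restrictπ (G : Glueing T S c) {i : Fin c.n} {W : Set X} (hWU : W ⊆ c.U i)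
    {a b : T.Ob} {r s : ℕ} (hr : G.e a = r) (hs : G.e b = s) :
    T.cat.Hom a b →ₗ[ℂ] C(W, S.Hom r s) where
  toFun t := (G.π i hr hs t).comp ⟨Set.inclusion hWU, continuous_inclusion hWU⟩
  map_add' t t' := by rw [map_add]; rfl
  map_smul' z t := by rw [map_smul]; rfl

/-- Extend the section over `W` to `X`, multiply by a bump function equal to `1` on `W` and
supported in `U i`, and spread the result over the other members along the cocycle. -/
theorem restrictπ_surjective (hS : Amenable S.toTensorCStarCat) (G : Glueing T S c) {i : Fin c.n}
    {W : Set X} (hW : IsClosed W) (hWU : W ⊆ c.U i) {a b : T.Ob} {r s : ℕ} (hr : G.e a = r)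
    (hs : G.e b = s) : Function.Surjective (G.restrictπ hWU hr hs) := by
  intro σ
  let _ : NormedSpace ℝ (S.Hom r s) := NormedSpace.restrictScalars ℝ ℂ _
  obtain ⟨τ, hτ⟩ := exists_banach_extension hW σ
  obtain ⟨θ, hθ, hθ1⟩ := exists_bump (c.isOpen i) hW hWU
  obtain ⟨v, hv⟩ := c.exists_section hS i hθ τ
  refine ⟨(G.equiv hr hs).symm v, ?_⟩
  ext y
  change G.π i hr hs _ ⟨y.1, hWU y.2⟩ = σ y
  rw [π_equiv_symm, hv, hθ1 y y.2, one_smul, hτ]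

/-- One inclusion holds because evaluations are contractive and kill the generators. For the other,
factor the arrow as `f t'`, with `f` vanishing wherever the arrow does: it is then itself a
generator, and no limit is needed. -/
theorem ker_restrictπ (hS : Amenable S.toTensorCStarCat) (G : Glueing T S c) {i : Fin c.n}
    {W : Set X} (hWU : W ⊆ c.U i) {a b : T.Ob} {r s : ℕ} (hr : G.e a = r) (hs : G.e b = s) :
    T.vanishing W a b = LinearMap.ker (G.restrictπ hWU hr hs) := by
  ext t
  refine ⟨fun h => ?_, fun h => ?_⟩
  · rw [LinearMap.mem_ker]
    ext x
    let F : T.cat.Hom a b →L[ℂ] S.Hom r s :=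
      LinearMap.mkContinuous ((G.fibre hS rfl i ⟨x, hWU x.2⟩).app hr hs) 1
        fun t => by rw [one_mul]; exact FibreFunctor.norm_le _ hr hs t
    refine T.eq_zero_of_mem_vanishing F (fun f t hf => ?_) h
    change G.π i hr hs (T.act f t) ⟨x, hWU x.2⟩ = 0
    rw [π_act, hf x x.2, zero_smul]
  · obtain ⟨f, t', rfl, hf⟩ := G.exists_factor hr hs t
    exact T.act_mem_vanishing (fun x hx => hf i ⟨x, hWU hx⟩ (DFunLike.congr_fun h ⟨x, hx⟩)) t'

/-- The local charts of a glueing. -/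
noncomputable def localChart (hS : Amenable S.toTensorCStarCat) (G : Glueing T S c) {i : Fin c.n}
    {W : Set X} (hW : IsClosed W) (hWU : W ⊆ c.U i) : LocalChart T S G.e W where
  app {a b _ _} hr hs := Submodule.quotEquivOfEq (T.vanishing W a b) _
      (G.ker_restrictπ hS hWU hr hs) ≪≫ₗ
    (G.restrictπ hWU hr hs).quotKerEquivOfSurjective (G.restrictπ_surjective hS hW hWU hr hs)
  map_id h x := G.map_id i h ⟨x, hWU x.2⟩
  map_comp hp hr hs t' t x := G.map_comp i hp hr hs t' t ⟨x, hWU x.2⟩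
  map_adj hr hs t x := G.map_adj i hr hs t ⟨x, hWU x.2⟩
  map_act hr hs f t x := G.π_act i hr hs f t ⟨x, hWU x.2⟩
  map_tensor hr hs hr' hs' t t' x := G.map_tensor i hr hs hr' hs' t t' ⟨x, hWU x.2⟩
  map_braid hr hs x := G.map_braid i hr hs ⟨x, hWU x.2⟩

theorem locallyTrivial (hS : Amenable S.toTensorCStarCat) (G : Glueing T S c) :
    LocallyTrivial T S := by
  refine ⟨G.e, fun x => ?_⟩
  obtain ⟨i, hi⟩ := c.cover x
  obtain ⟨W, hW, hWc, hWU⟩ := exists_mem_nhds_isClosed_subset ((c.isOpen i).mem_nhds hi)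
  exact ⟨W, hWc, hW, ⟨G.localChart hS hWc hWU⟩⟩

end Glueing

end Charts

/-! ### The glueing of trivial bundles along a cocycle -/

section OperationsContinuous

variable {Ob : Type w} (C : CStarCat.{v} Ob)

theorem CStarCat.continuous_comp (a b c : Ob) :
    Continuous fun p : C.Hom b c × C.Hom a b => C.comp p.1 p.2 :=
  IsBoundedBilinearMap.continuous (𝕜 := ℂ)
    { add_left t' s' t := C.add_comp t' s' t
      smul_left z t' t := C.smul_comp z t' t
      add_right t' t s := C.comp_add t' t s
      smul_right z t' t := C.comp_smul z t' t
      bound := ⟨1, one_pos, fun t' t => by rw [one_mul]; exact C.norm_comp_le t' t⟩ }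

theorem CStarCat.continuous_adj (a b : Ob) : Continuous fun t : C.Hom a b => C.adj t :=
  (AddMonoidHomClass.isometry_of_norm (AddMonoidHom.mk' (fun t : C.Hom a b => C.adj t) C.adj_add)
    C.norm_adj).continuous

theorem TensorCStarCat.continuous_tensor [AddMonoid Ob] (C : TensorCStarCat.{v} Ob)
    (a b c d : Ob) : Continuous fun p : C.Hom a b × C.Hom c d => C.tensor p.1 p.2 :=
  IsBoundedBilinearMap.continuous (𝕜 := ℂ)
    { add_left t' s' t := C.add_tensor t' s' t
      smul_left z t' t := C.smul_tensor z t' t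
      add_right t' t s := C.tensor_add t' t s
      smul_right z t' t := C.tensor_smul z t' t
      bound := ⟨1, one_pos, fun t' t => by rw [one_mul]; exact C.norm_tensor_le t' t⟩ }

end OperationsContinuous

section Construction

open scoped BoundedContinuousFunction

variable {X : Type u} [TopologicalSpace X] {S : SymTensorCStarCat.{v} ℕ}

/-- The bounded sections along a cocycle. -/
def Cocycle.bddSections (c : Cocycle X (AutEps S)) (r s : ℕ) :
    Submodule ℂ (∀ i, c.U i →ᵇ S.Hom r s) where
  carrier := {v | ∀ (i j : Fin c.n) (x : X) (hi : x ∈ c.U i) (hj : x ∈ c.U j),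
    v i ⟨x, hi⟩ = (c.g i j x).app r s (v j ⟨x, hj⟩)}
  add_mem' {v v'} hv hv' i j x hi hj := by
    simp only [Pi.add_apply, BoundedContinuousFunction.coe_add, map_add]
    rw [hv i j x hi hj, hv' i j x hi hj]
  zero_mem' i j x hi hj := by simp
  smul_mem' z v hv i j x hi hj := by
    simp only [Pi.smul_apply, BoundedContinuousFunction.coe_smul, map_smul]
    rw [hv i j x hi hj]

/-- The Banach space of bounded sections along a cocycle. -/
def Cocycle.Sec (c : Cocycle X (AutEps S)) (r s : ℕ) : Type (max u v) := c.bddSections r s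

namespace Cocycle.Sec

variable {c : Cocycle X (AutEps S)} {r s : ℕ}

noncomputable instance : NormedAddCommGroup (c.Sec r s) :=
  inferInstanceAs (NormedAddCommGroup (c.bddSections r s))

noncomputable instance : NormedSpace ℂ (c.Sec r s) :=
  inferInstanceAs (NormedSpace ℂ (c.bddSections r s))

theorem isClosed_bddSections : IsClosed (c.bddSections r s : Set (∀ i, c.U i →ᵇ S.Hom r s)) := by
  have h : (c.bddSections r s : Set (∀ i, c.U i →ᵇ S.Hom r s)) =
      ⋂ (i) (j) (x) (hi : x ∈ c.U i) (hj : x ∈ c.U j),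
        {v | v i ⟨x, hi⟩ = (c.g i j x).app r s (v j ⟨x, hj⟩)} := by
    ext v
    simp only [Set.mem_iInter]; rfl
  rw [h]
  have h1 : ∀ i (x : c.U i), Continuous fun v : ∀ i, c.U i →ᵇ S.Hom r s => v i x :=
    fun i x => (continuous_eval_const x).comp (continuous_apply i)
  exact isClosed_iInter fun i => isClosed_iInter fun j => isClosed_iInter fun x =>
    isClosed_iInter fun hi => isClosed_iInter fun hj =>
      isClosed_eq (h1 i _) (((c.g i j x).app r s).continuous.comp (h1 j _))

instance : CompleteSpace (c.Sec r s) :=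
  (isClosed_bddSections (c := c) (r := r) (s := s)).completeSpace_coe

/-- The value of a section at a point. -/
def eval (v : c.Sec r s) (i : Fin c.n) (x : c.U i) : S.Hom r s := v.1 i x

theorem continuous_eval (v : c.Sec r s) (i : Fin c.n) : Continuous (v.eval i) :=
  (v.1 i).continuous

theorem ext {v v' : c.Sec r s} (h : ∀ i x, v.eval i x = v'.eval i x) : v = v' :=
  Subtype.ext (funext fun i => BoundedContinuousFunction.ext (h i))

theorem compat (v : c.Sec r s) (i j : Fin c.n) (x : X) (hi : x ∈ c.U i) (hj : x ∈ c.U j) :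
    v.eval i ⟨x, hi⟩ = (c.g i j x).app r s (v.eval j ⟨x, hj⟩) := v.2 i j x hi hj

theorem norm_le (v : c.Sec r s) {C : ℝ} (hC : 0 ≤ C) : ‖v‖ ≤ C ↔ ∀ i x, ‖v.eval i x‖ ≤ C := by
  change ‖v.1‖ ≤ C ↔ _
  rw [pi_norm_le_iff_of_nonneg hC]
  exact forall_congr' fun i => BoundedContinuousFunction.norm_le hC

theorem norm_eval_le (v : c.Sec r s) (i : Fin c.n) (x : c.U i) : ‖v.eval i x‖ ≤ ‖v‖ :=
  (v.norm_le (norm_nonneg v)).1 le_rfl i x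

variable [CompactSpace X]

/-- Sections along a cocycle over a compact space are bounded. -/
def mk (f : ∀ i, c.U i → S.Hom r s) (hf : ∀ i, Continuous (f i))
    (h : ∀ (i j : Fin c.n) (x : X) (hi : x ∈ c.U i) (hj : x ∈ c.U j),
      f i ⟨x, hi⟩ = (c.g i j x).app r s (f j ⟨x, hj⟩)) : c.Sec r s :=
  ⟨fun i => ⟨⟨f i, hf i⟩, by
    -- The norms of the members patch to one continuous function on the compact space `X`, although
    -- the sets `U i` are not compact.
    obtain ⟨N, hN⟩ := Cocycle.sections_exists_norm (c := c) ⟨fun i => ⟨f i, hf i⟩, h⟩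
    have h1 : ∀ x : c.U i, ‖f i x‖ ≤ ‖N‖ := fun x =>
      (hN i x).symm.trans_le ((le_abs_self _).trans (N.norm_coe_le_norm x))
    exact ⟨‖N‖ + ‖N‖, fun x y => (dist_le_norm_add_norm _ _).trans (add_le_add (h1 x) (h1 y))⟩⟩,
    fun i j x hi hj => h i j x hi hj⟩

theorem eval_mk (f : ∀ i, c.U i → S.Hom r s) (hf h) (i : Fin c.n) (x : c.U i) :
    (mk (c := c) f hf h).eval i x = f i x := rfl

theorem norm_le_norm_mk (f : ∀ i, c.U i → S.Hom r s) (hf h) (i : Fin c.n) (x : c.U i) :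
    ‖f i x‖ ≤ ‖mk (c := c) f hf h‖ := (mk f hf h).norm_eval_le i x

end Cocycle.Sec

variable [CompactSpace X] (c : Cocycle X (AutEps S))

open Cocycle

/-- The C*-category of sections along a cocycle. -/
noncomputable def glueCStarCat : CStarCat.{max u v} (ULift.{w} ℕ) where
  Hom a b := c.Sec a.down b.down
  id a := Sec.mk (fun _ _ => S.id a.down) (fun _ => continuous_const)
    fun i j x _ _ => ((c.g i j x).map_id _).symm
  comp t' t := Sec.mk (fun i x => S.comp (t'.eval i x) (t.eval i x))
    (fun i => (S.continuous_comp _ _ _).comp ((t'.continuous_eval i).prodMk (t.continuous_eval i)))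
    fun i j x hi hj => by
      rw [AutEps.map_comp, ← t'.compat i j x hi hj, ← t.compat i j x hi hj]
  adj t := Sec.mk (fun i x => S.adj (t.eval i x))
    (fun i => (S.continuous_adj _ _).comp (t.continuous_eval i))
    fun i j x hi hj => by rw [AutEps.map_adj, ← t.compat i j x hi hj]
  comp_id t := Sec.ext fun i x => S.comp_id _
  id_comp t := Sec.ext fun i x => S.id_comp _
  comp_assoc t'' t' t := Sec.ext fun i x => S.comp_assoc _ _ _
  comp_add t' t s := Sec.ext fun i x => S.comp_add _ _ _
  add_comp t' s' t := Sec.ext fun i x => S.add_comp _ _ _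
  comp_smul z t' t := Sec.ext fun i x => S.comp_smul _ _ _
  smul_comp z t' t := Sec.ext fun i x => S.smul_comp _ _ _
  norm_comp_le t' t := by
    rw [Sec.norm_le _ (by positivity)]
    exact fun i x => (S.norm_comp_le _ _).trans
      (mul_le_mul (t'.norm_eval_le i x) (t.norm_eval_le i x) (norm_nonneg _) (norm_nonneg _))
  adj_adj t := Sec.ext fun i x => S.adj_adj _
  adj_add t s := Sec.ext fun i x => S.adj_add _ _
  adj_smul z t := Sec.ext fun i x => S.adj_smul _ _
  adj_comp t' t := Sec.ext fun i x => S.adj_comp _ _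
  norm_adj t := by
    refine le_antisymm ?_ ?_
    · rw [Sec.norm_le _ (norm_nonneg _)]
      exact fun i x => (S.norm_adj _).trans_le (t.norm_eval_le i x)
    · rw [Sec.norm_le _ (norm_nonneg _)]
      exact fun i x => le_trans (S.norm_adj _).ge
        (Sec.norm_le_norm_mk (c := c) (fun i x => S.adj (t.eval i x)) _ _ i x)
  cstar_identity t := by
    refine le_antisymm ?_ ?_
    · rw [Sec.norm_le _ (by positivity)]
      intro i x
      rw [Sec.eval_mk, Sec.eval_mk, S.cstar_identity]
      exact pow_le_pow_left₀ (norm_nonneg _) (t.norm_eval_le i x) 2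
    -- In the form `‖t‖ ≤ √‖t* ∘ t‖` the lower bound can be checked pointwise, where it is the
    -- C*-identity of the fibre.
    · refine (Real.le_sqrt (norm_nonneg _) (norm_nonneg _)).1 ?_
      rw [Sec.norm_le _ (Real.sqrt_nonneg _)]
      intro i x
      refine Real.le_sqrt_of_sq_le ?_
      exact le_trans (S.cstar_identity _).ge
        (Sec.norm_le_norm_mk (c := c) (fun i x => S.comp (S.adj (t.eval i x)) (t.eval i x)) _ _ i x)

theorem glueCStarCat_eval_castHom {a a' b b' : ULift.{w} ℕ} (ha : a = a') (hb : b = b')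
    (t : (glueCStarCat c).Hom a b) (i : Fin c.n) (x : c.U i) :
    Sec.eval ((glueCStarCat c).castHom ha hb t) i x =
      S.castHom (congrArg ULift.down ha) (congrArg ULift.down hb) (Sec.eval t i x) := by
  subst ha hb; rfl

/-- The tensor C*-category of sections along a cocycle. -/
noncomputable def glueTensorCStarCat : TensorCStarCat.{max u v} (ULift.{w} ℕ) where
  toCStarCat := glueCStarCat c
  tensor {a b a' b'} t t' := Sec.mk (r := a.down + a'.down) (s := b.down + b'.down)
    (fun i x => S.tensor (Sec.eval t i x) (Sec.eval t' i x))
    (fun i => (S.continuous_tensor _ _ _ _).comp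
      ((Sec.continuous_eval t i).prodMk (Sec.continuous_eval t' i)))
    fun i j x hi hj => by
      rw [AutEps.map_tensor, ← Sec.compat t i j x hi hj, ← Sec.compat t' i j x hi hj]
  tensor_add t s s' := Sec.ext fun i x => S.tensor_add _ _ _
  add_tensor t t' s := Sec.ext fun i x => S.add_tensor _ _ _
  tensor_smul z t s := Sec.ext fun i x => S.tensor_smul _ _ _
  smul_tensor z t s := Sec.ext fun i x => S.smul_tensor _ _ _
  norm_tensor_le t s := by
    refine (Sec.norm_le _ (by positivity)).2 ?_
    exact fun i x => (S.norm_tensor_le _ _).trans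
      (mul_le_mul (Sec.norm_eval_le t i x) (Sec.norm_eval_le s i x) (norm_nonneg _)
        (norm_nonneg _))
  tensor_id a b := Sec.ext fun i x => S.tensor_id _ _
  tensor_comp t' t s' s := Sec.ext fun i x => S.tensor_comp _ _ _ _
  tensor_adj t s := Sec.ext fun i x => S.tensor_adj _ _
  tensor_assoc t s r := Sec.ext fun i x =>
    (glueCStarCat_eval_castHom c _ _ _ i x).trans (S.tensor_assoc _ _ _)
  id_zero_tensor t := Sec.ext fun i x =>
    (glueCStarCat_eval_castHom c _ _ _ i x).trans (S.id_zero_tensor _)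
  tensor_id_zero t := Sec.ext fun i x =>
    (glueCStarCat_eval_castHom c _ _ _ i x).trans (S.tensor_id_zero _)

/-- The symmetric tensor C*-category of sections along a cocycle. -/
noncomputable def glueSymTensorCStarCat : SymTensorCStarCat.{max u v} (ULift.{w} ℕ) where
  toTensorCStarCat := glueTensorCStarCat c
  braid a b := Sec.mk (r := a.down + b.down) (s := b.down + a.down)
    (fun _ _ => S.braid a.down b.down) (fun _ => continuous_const)
    fun i j x _ _ => ((c.g i j x).map_braid _ _).symm
  braid_adj_comp a b := Sec.ext fun i x => S.braid_adj_comp _ _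
  braid_comp_adj a b := Sec.ext fun i x => S.braid_comp_adj _ _
  braid_naturality t t' := Sec.ext fun i x => S.braid_naturality _ _
  braid_symm a b := Sec.ext fun i x => S.braid_symm _ _
  braid_zero a := Sec.ext fun i x =>
    (glueCStarCat_eval_castHom c _ _ _ i x).trans (S.braid_zero _)
  zero_braid a := Sec.ext fun i x =>
    (glueCStarCat_eval_castHom c _ _ _ i x).trans (S.zero_braid _)
  braid_hexagon a b d := Sec.ext fun i x => by
    refine (glueCStarCat_eval_castHom c _ _ _ i x).trans ((S.braid_hexagon _ _ _).trans
      (congrArg (S.comp _) (Eq.symm ?_)))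
    exact glueCStarCat_eval_castHom c rfl (add_assoc a d b).symm _ i x

/-- The scalar sections along a cocycle. -/
noncomputable def scalarSections : C(X, ℂ) →ₗ[ℂ] c.Sec 0 0 where
  toFun f := Sec.mk (fun _ x => f x • S.id 0) (fun _ => by fun_prop)
    fun i j x _ _ => by rw [map_smul, AutEps.map_id]
  map_add' f f' := Sec.ext fun i x => add_smul _ _ _
  map_smul' z f := Sec.ext fun i x => mul_smul _ _ _

/-- Autofunctors fix `S.id 0` and hence all of `(ι, ι) = ℂ 1`. The members of a section of `(ι, ι)`
therefore agree on overlaps and patch to one continuous function on `X`. -/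
theorem scalarSections_bijective (hι : Function.Bijective fun z : ℂ => z • S.id 0) :
    Function.Bijective (scalarSections c) := by
  let L : ℂ ≃ₗ[ℂ] S.Hom 0 0 := LinearEquiv.ofBijective (LinearMap.toSpanSingleton ℂ _ (S.id 0)) hι
  have hL : ∀ z, L z = z • S.id 0 := fun z => rfl
  have hLc : Continuous L.symm := L.toContinuousLinearEquiv.symm.continuous
  have hg : ∀ (α : AutEps S) v, L.symm (α.app 0 0 v) = L.symm v := fun α v => by
    obtain ⟨z, rfl⟩ := L.surjective v
    rw [hL, map_smul, AutEps.map_id]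
  choose k hk using c.cover
  refine ⟨fun f f' h => ?_, fun v => ?_⟩
  · ext x
    exact hι.1 (congrArg (fun v => Sec.eval v (k x) ⟨x, hk x⟩) h)
  · have h1 : ∀ i x (hx : x ∈ c.U i),
        L.symm (v.eval (k x) ⟨x, hk x⟩) = L.symm (v.eval i ⟨x, hx⟩) := fun i x hx => by
      rw [v.compat (k x) i x (hk x) hx, hg]
    refine ⟨⟨fun x => L.symm (v.eval (k x) ⟨x, hk x⟩), continuous_iff_continuousAt.2 fun x => ?_⟩,
      Sec.ext fun i x => ?_⟩
    · exact continuousAt_of_eventually_eq (c.isOpen (k x)) (hk x)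
        ⟨_, hLc.comp (v.continuous_eval (k x))⟩ (.of_forall fun y hy => h1 (k x) y hy)
    · change L (L.symm (v.eval (k x) ⟨x, hk x⟩)) = v.eval i x
      rw [h1 i x x.2, LinearEquiv.apply_symm_apply]

/-- The symmetric tensor C*-category over `X` of sections along a cocycle. -/
noncomputable def glueSymCatOver (hι : Function.Bijective fun z : ℂ => z • S.id 0) :
    SymCatOver.{u, max u v, w} X where
  Ob := ULift.{w} ℕ
  cat := glueSymTensorCStarCat c
  scal := LinearEquiv.ofBijective (scalarSections c) (scalarSections_bijective c hι)
  scal_one := Sec.ext fun i x => one_smul ℂ (S.id 0)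
  scal_mul f f' := Sec.ext fun i x => by
    change (f x * f' x) • S.id 0 = S.comp (f x • S.id 0) (f' x • S.id 0)
    rw [S.smul_comp, S.comp_smul, S.comp_id, mul_smul]
  scal_star f := Sec.ext fun i x => by
    change (starRingEnd ℂ (f x)) • S.id 0 = S.adj (f x • S.id 0)
    rw [S.adj_smul, S.adj_id]

/-- The members of a section, as an arrow between the given objects. -/
noncomputable def glueProj (i : Fin c.n) {a b : ULift.{w} ℕ} {r s : ℕ}
    (hr : AddEquiv.ulift a = r) (hs : AddEquiv.ulift b = s) :
    (glueCStarCat c).Hom a b →ₗ[ℂ] C(c.U i, S.Hom r s) := by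
  subst hr hs
  exact
    { toFun t := ⟨Sec.eval t i, Sec.continuous_eval t i⟩
      map_add' _ _ := rfl
      map_smul' _ _ := rfl }

/-- The sections along a cocycle form a glueing. -/
noncomputable def glueing (hι : Function.Bijective fun z : ℂ => z • S.id 0) :
    Glueing (glueSymCatOver.{u, v, w} c hι) S c where
  e := AddEquiv.ulift
  π i _ _ _ _ hr hs := glueProj c i hr hs
  glue i j x hi hj a b r s hr hs t := by
    subst hr hs
    exact Sec.compat t i j x hi hj
  existsUnique := by
    intro a b r s hr hs v hv
    subst hr hs
    refine ⟨Sec.mk (fun i => v i) (fun i => (v i).continuous) hv, fun i => rfl, fun t ht => ?_⟩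
    exact Sec.ext fun i x => DFunLike.congr_fun (ht i) x
  map_id i a r h x := by subst h; rfl
  map_comp i a b d p r s hp hr hs t' t x := by subst hp hr hs; rfl
  map_adj i a b r s hr hs t x := by subst hr hs; rfl
  map_scal i f x := rfl
  map_tensor i a b a' b' r s r' s' hr hs hr' hs' t t' x := by subst hr hs hr' hs'; rfl
  map_braid i a b r s hr hs x := by subst hr hs; rfl

end Construction

theorem mainTheorem4 (X : Type u) [TopologicalSpace X] [CompactSpace X] [T2Space X]
    (S : SymTensorCStarCat.{v} ℕ)
    (hι : Function.Bijective fun z : ℂ => z • S.id 0)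
    (hS : Amenable S.toTensorCStarCat) :
    ∃ Φ : SymClasses.{u, v, max u v, w} X S ≃ CohomologySet X (AutEps S),
      -- from a category to the class of the transition functions of its local charts
      (∀ T : LTSymCat.{u, v, max u v, w} X S, Nonempty (ChartSystem T.1 S) ∧
        ∀ P : ChartSystem T.1 S,
          (∃ c : Cocycle X (AutEps S), IsTransitionCocycle P c) ∧
          ∀ c : Cocycle X (AutEps S), IsTransitionCocycle P c → Φ ⟦T⟧ = ⟦c⟧) ∧
      -- from a cocycle to the glueing of the trivial bundles
      (∀ c : Cocycle X (AutEps S),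
        (∃ T : LTSymCat.{u, v, max u v, w} X S, Nonempty (Glueing T.1 S c)) ∧
        ∀ T : LTSymCat.{u, v, max u v, w} X S, Nonempty (Glueing T.1 S c) → Φ.symm ⟦c⟧ = ⟦T⟧) := by
  have h1 : ∀ T : LTSymCat.{u, v, max u v, w} X S,
      ∃ c : Cocycle X (AutEps S), Nonempty (Glueing T.1 S c) := fun T => by
    obtain ⟨P⟩ := T.2.nonempty_chartSystem
    obtain ⟨c, hc⟩ := P.exists_cocycle hS
    exact ⟨c, hc.nonempty_glueing⟩
  choose cl hcl using h1
  have h2 : ∀ c : Cocycle X (AutEps S),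
      ∃ T : LTSymCat.{u, v, max u v, w} X S, Nonempty (Glueing T.1 S c) := fun c =>
    ⟨⟨glueSymCatOver c hι, (glueing c hι).locallyTrivial hS⟩, ⟨glueing c hι⟩⟩
  -- The class of `cl T` is independent of the choice: it is that of any cocycle along which `T` is
  -- a glueing.
  have h3 : ∀ {T : LTSymCat.{u, v, max u v, w} X S} {c : Cocycle X (AutEps S)},
      Nonempty (Glueing T.1 S c) →
        (⟦cl T⟧ : CohomologySet X (AutEps S)) = ⟦c⟧ := fun {T c} ⟨G⟩ =>
    Quotient.sound ((hcl T).some.equivalent hS G)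
  let Φ : SymClasses.{u, v, max u v, w} X S → CohomologySet X (AutEps S) :=
    Quotient.lift (fun T => ⟦cl T⟧) fun T T' ⟨F⟩ => h3 ⟨(hcl T').some.comap F⟩
  have hΦ : ∀ {T : LTSymCat.{u, v, max u v, w} X S} {c : Cocycle X (AutEps S)},
      Nonempty (Glueing T.1 S c) → Φ ⟦T⟧ = ⟦c⟧ := h3
  have hbij : Function.Bijective Φ := by
    refine ⟨fun T T' h => ?_, fun c => ?_⟩
    · induction T using Quotient.inductionOn with | h T => ?_
      induction T' using Quotient.inductionOn with | h T' => ?_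
      -- Move the glueing of `T'` to the cocycle of `T`; two glueings along one cocycle are
      -- isomorphic.
      obtain ⟨G⟩ := (hcl T').some.nonempty_of_equivalent hS (c := cl T) (Quotient.exact h)
      exact Quotient.sound ((hcl T).some.nonempty_iso G)
    · induction c using Quotient.inductionOn with | h c => ?_
      obtain ⟨T, hT⟩ := h2 c
      exact ⟨⟦T⟧, hΦ hT⟩
  refine ⟨Equiv.ofBijective Φ hbij, fun T => ⟨T.2.nonempty_chartSystem, fun P =>
    ⟨P.exists_cocycle hS, fun c hc => hΦ hc.nonempty_glueing⟩⟩, fun c => ⟨h2 c, fun T hT => ?_⟩⟩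
  exact (Equiv.symm_apply_eq _).2 (hΦ hT).symm
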